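/- **Setting.** Let $A\in\mathbb Z^{2\times2}$ be a scaling matrix (non-negative integer entries, all eigenvalues of modulus greater than $1$) and write $A^j=\begin{pmatrix}\lambda_1^{(j)}&\lambda_2^{(j)}\\ \lambda_3^{(j)}&\lambda_4^{(j)}\end{pmatrix}$ for $j\ge 0$. Let $(V_j)_{j\in\mathbb Z}$ be a multiresolution analysis of $L^2(\mathbb R^2)$ for the dilation $A$ with scaling function $\phi$, that is: the $V_j$ are closed subspaces, $V_j\subset V_{j+1}$, $\bigcap_j V_j=\{0\}$, $\bigcup_jV_j$ is dense, $f\in V_j\Leftrightarrow f(A\cdot)\in V_{j+1}$, and $\{\phi(\cdot-m)\}_{m\in\mathbb Z^2}$ is an orthonormal basis of $V_0$. For a function $f$ put $f_{j,m}=|\det A|^{j/2}f(A^j\cdot-m)$. Let $\psi^1,\dots,\psi^{|\det A|-1}\in L^2(\mathbb R^2)$ be wavelets: for every $j\ge0$ the $\psi^p_{j,m}$ ($m\in\mathbb Z^2$, $1\le p\le|\det A|-1$) form an orthonormal basis of the orthogonal complement of $V_j$ in $V_{j+1}$. Let $a\ge1$ be an integer such that $\phi$ and all $\psi^p$ are supported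 in $[0,a]^2$. Put $$V_0^{(a)}=\operatorname{span}\{\phi_{0,m}:-a<m_1,m_2<a\},$$ $$W_j^{(a)}=\operatorname{span}\{\psi^p_{j,m}: -a<m_1<a(\lambda_1^{(j)}+\lambda_2^{(j)}),\ -a<m_2<a(\lambda_3^{(j)}+\lambda_4^{(j)}),\ 1\le p\le|\det A|-1\},$$ $\mathcal R_{N_J}=V_0^{(a)}\oplus W_0^{(a)}\oplus\dots\oplus W_{J-1}^{(a)}$, where $$N_J=(2a-1)^2+(|\det A|-1)\sum_{j=0}^{J-1}\bigl(a(\lambda_1^{(j)}+\lambda_2^{(j)}+1)-1\bigr)\bigl(a(\lambda_3^{(j)}+\lambda_4^{(j)}+1)-1\bigr)$$ is the number of the generating functions, and let $\mathcal R$ be the closed linear span of the functions of all scales $j\ge0$. Let $T_1,T_2>0$ be such that $\mathcal R\subset L^2([-T_1,T_2]^2)$. For $0<\varepsilon\le\frac1{T_1+T_2}$, $l\in\mathbb Z^2$ and $M=(M_1,M_2)$ let $$s_l^{(\varepsilon)}=\varepsilon e^{2\pi i\varepsilon\langle l,\cdot\rangle}\chi_{[-T_1,T_2]^2},\qquad I_M=\{l\in\mathbb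 Z^2:|l_i|\le M_i\},\qquad \mathcal S_M^{(\varepsilon)}=\operatorname{span}\{s_l^{(\varepsilon)}:l\in I_M\}.$$ For subspaces $U,V$ let $\cos\omega(U,V)=\inf_{u\in U,\|u\|=1}\|P_Vu\|$. *Stable sampling rate.* Let $Q_Mh=\sum_{l\in I_M}\langle h,s_l^{(\varepsilon)}\rangle s_l^{(\varepsilon)}$ and $m(g)=(\langle g,s_l^{(\varepsilon)}\rangle)_{l\in I_M}$. When for every $f\in L^2(\mathbb R^2)$ there is a unique $G_Mf\in\mathcal R_{N_J}$ with $\langle Q_MG_Mf,r\rangle=\langle Q_Mf,r\rangle$ for all $r\in\mathcal R_{N_J}$, we say that the generalized sampling reconstruction $G_M$ exists. Its reconstruction constant $C(G_M)\in[0,\infty]$ is the maximum of the quasi-optimality constant, i.e. the least $c$ with $\|f-G_Mf\|\le c\|f-P_{\mathcal R_{N_J}}f\|$ for all $f$, and of the absolute condition number $\sup_f\lim_{\eta\searrow0}\sup_{0<\|m(g)\|_{\ell^2}\le\eta}\|G_M(f+g)-G_Mf\|/\|m(g)\|_{\ell^2}$. For $\theta>1$ let $\Theta(N_J,\theta)$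 be the least number of samples $|I_M|=(2M_1+1)(2M_2+1)$, over integers $M_1,M_2\ge1$, for which $G_M$ exists and $C(G_M)<\theta$. *Mesh norm assumption.* For $M_1,M_2\ge1$ let $L_M=[-M_1,M_1]\times[-M_2,M_2]$, let $\mu$ be the Lebesgue measure, and let $$\delta=\max_{x\in\varepsilon A^{-J}(L_M)}\ \min_{l\in I_M}\ \min_{k\in\varepsilon A^{-J}(\mathbb Z^2)}\|x-\varepsilon A^{-J}l+k\|_\infty .$$ The assumption is: there is $\varepsilon_0\in(0,\frac1{T_1+T_2}]$ such that for every $J\ge1$ there are integers $L_1,L_2,L_3,L_4$ such that every $\varphi\in\mathcal R_{N_J}$ has the form $\varphi=\sum_{l_1=L_3}^{L_1}\sum_{l_2=L_4}^{L_2}\alpha_{l_1,l_2}\phi_{J,(l_1,l_2)}$, and integers $M_1,M_2\ge1$, for which, with $\varepsilon=\varepsilon_0$, $$\delta<\frac{\log\bigl(\frac1{\sqrt{\mu(L_M)}}+1\bigr)}{4\pi\max\{|L_1|,|L_2|,|L_3|,|L_4|\}} .$$ **Theorem.** Let $\theta>1$. 1. There is a constant $S^{(\theta)}>0$, independent of $J$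 and $\varepsilon$, such that for all $J\ge0$, all $\varepsilon\in(0,\frac1{T_1+T_2}]$ and all $M=(M_1,M_2)$ with $$M_1\ge\frac{\lambda_1^{(J)}+\lambda_3^{(J)}}{\varepsilon}S^{(\theta)},\qquad M_2\ge\frac{\lambda_2^{(J)}+\lambda_4^{(J)}}{\varepsilon}S^{(\theta)}$$ one has $\cos\omega(\mathcal R_{N_J},\mathcal S_M^{(\varepsilon)})\ge\frac1\theta$. 2. If the mesh norm assumption holds, then for every $\varepsilon\in(0,\frac1{T_1+T_2}]$ the stable sampling rate $\Theta(N_J,\theta)$ is well defined (finite) for every $J\ge0$, and $\Theta(N_J,\theta)=O(N_J)$ as $J\to\infty$ (equivalently, as $N_J\to\infty$). -/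

import Mathlib

open MeasureTheory Filter Asymptotics
open scoped ENNReal Matrix InnerProductSpace

noncomputable section

namespace GSWavelet

/-! ### Generalized sampling in a Hilbert space -/

section Abstract

variable {H : Type*} [NormedAddCommGroup H] [InnerProductSpace ℂ H]

/-- The infimum cosine angle `cos ω(U, V) = inf { ‖P_V u‖ : u ∈ U, ‖u‖ = 1 }`. -/
def cosAngle (U V : Submodule ℂ H) [V.HasOrthogonalProjection] : ℝ :=
  sInf {r : ℝ | ∃ u ∈ U, ‖u‖ = 1 ∧ r = ‖V.starProjection u‖}

variable {ι : Type*}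

/-- The operator `h ↦ ∑_{l ∈ I} ⟨h, s_l⟩ s_l`. Mathlib's inner product is linear in the second
argument, so the sample `⟨h, s_l⟩` (linear in `h`) is `inner ℂ (s l) h`. -/
def sampOp (s : ι → H) (I : Finset ι) (h : H) : H :=
  ∑ l ∈ I, inner ℂ (s l) h • s l

/-- The `ℓ²` norm of the vector of samples `(⟨g, s_l⟩)_{l ∈ I}`. -/
def sampNorm (s : ι → H) (I : Finset ι) (g : H) : ℝ :=
  Real.sqrt (∑ l ∈ I, ‖inner ℂ (s l) g‖ ^ 2)

/-- `G` is the generalized sampling reconstruction with reconstruction space `R` from the samples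
indexed by `I`: for every `f`, the vector `G f` is the unique `g ∈ R` that satisfies
`⟨∑ ⟨g, s_l⟩ s_l, r⟩ = ⟨∑ ⟨f, s_l⟩ s_l, r⟩` for all `r ∈ R`. -/
def IsGenSampling (R : Submodule ℂ H) (s : ι → H) (I : Finset ι) (G : H → H) : Prop :=
  ∀ f g : H, (g ∈ R ∧ ∀ r ∈ R, inner ℂ r (sampOp s I g) = inner ℂ r (sampOp s I f)) ↔ g = G f

/-- The quasi-optimality constant: the least `c` with `‖f - F f‖ ≤ c ‖f - P_R f‖` for all `f`
(infinite if there is none). -/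
def quasiOpt (R : Submodule ℂ H) [R.HasOrthogonalProjection] (F : H → H) : ℝ≥0∞ :=
  sInf {c : ℝ≥0∞ | ∀ f : H,
    ENNReal.ofReal ‖f - F f‖ ≤ c * ENNReal.ofReal ‖f - R.starProjection f‖}

/-- The absolute condition number
`sup_f lim_{η ↘ 0} sup_{0 < ‖m(g)‖ ≤ η} ‖F (f + g) - F f‖ / ‖m(g)‖`. The inner supremum is monotone
in `η`, so that its limit for `η ↘ 0` is its infimum over `η > 0`. -/
def condNumber (s : ι → H) (I : Finset ι) (F : H → H) : ℝ≥0∞ :=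
  ⨆ f : H, ⨅ (η : ℝ) (_ : 0 < η), ⨆ (g : H) (_ : 0 < sampNorm s I g ∧ sampNorm s I g ≤ η),
    ENNReal.ofReal (‖F (f + g) - F f‖ / sampNorm s I g)

/-- The reconstruction constant `C(F) = max {μ(F), κ(F)}`. -/
def recConst (R : Submodule ℂ H) [R.HasOrthogonalProjection] (s : ι → H) (I : Finset ι)
    (F : H → H) : ℝ≥0∞ :=
  max (quasiOpt R F) (condNumber s I F)

/-- The index box `I_M = {l ∈ ℤ² : -M_i ≤ l_i ≤ M_i}`. -/
def box (M : Fin 2 → ℕ) : Finset (Fin 2 → ℤ) :=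
  Fintype.piFinset fun i => Finset.Icc (-(M i : ℤ)) (M i : ℤ)

/-- The numbers of samples `|I_M|`, `M = (M_1, M_2)`, for which generalized sampling from the
samples in `I_M` is well defined with reconstruction constant less than `θ`. -/
def stableCounts (R : Submodule ℂ H) [R.HasOrthogonalProjection] (s : (Fin 2 → ℤ) → H)
    (θ : ℝ) : Set ℕ :=
  {n : ℕ | ∃ M : Fin 2 → ℕ, (∀ i, 1 ≤ M i) ∧ n = (box M).card ∧
    ∃ G : H → H, IsGenSampling R s (box M) G ∧ recConst R s (box M) G < ENNReal.ofReal θ}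

/-- The stable sampling rate: the least number of samples in `stableCounts`. It is meaningful only
when `stableCounts` is nonempty. -/
def stableSamplingRate (R : Submodule ℂ H) [R.HasOrthogonalProjection] (s : (Fin 2 → ℤ) → H)
    (θ : ℝ) : ℕ :=
  sInf (stableCounts R s θ)

end Abstract

/-! ### Wavelets on the plane -/

/-- The plane; its norm is the maximum norm, its volume the Lebesgue measure. -/
abbrev Plane : Type := Fin 2 → ℝ

/-- `L²(ℝ²)`. -/
abbrev L2 : Type := Lp ℂ 2 (volume : Measure Plane)

open Classical in
/-- The class in `L²(ℝ²)` of a square integrable function (and `0` for other functions). -/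
def toL2 (f : Plane → ℂ) : L2 :=
  if h : MemLp f 2 volume then h.toLp f else 0

/-- A scaling matrix: non-negative integer entries, all eigenvalues greater than one in modulus. -/
structure IsScalingMatrix (A : Matrix (Fin 2) (Fin 2) ℤ) : Prop where
  nonneg : ∀ i k, 0 ≤ A i k
  one_lt_eigenvalue : ∀ z : ℂ, (A.map (Int.cast : ℤ → ℂ)).charpoly.IsRoot z → 1 < ‖z‖

/-- `A ^ j` as a real matrix. -/
def powR (A : Matrix (Fin 2) (Fin 2) ℤ) (j : ℕ) : Matrix (Fin 2) (Fin 2) ℝ :=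
  (A ^ j).map (Int.cast : ℤ → ℝ)

/-- An integer vector as a point of the plane. -/
def intPt (m : Fin 2 → ℤ) : Plane := fun i => (m i : ℝ)

/-- The function `f_{j,m} = |det A|^{j/2} f(A^j · - m)`. -/
def atomFun (A : Matrix (Fin 2) (Fin 2) ℤ) (f : Plane → ℂ) (j : ℕ) (m : Fin 2 → ℤ) :
    Plane → ℂ :=
  fun x => (((|(A.det : ℝ)| ^ ((j : ℝ) / 2) : ℝ)) : ℂ) * f (powR A j *ᵥ x - intPt m)

/-- If `det A ≠ 0` and `f` is square integrable, so is `f_{j,m}`. -/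
theorem memLp_atomFun {A : Matrix (Fin 2) (Fin 2) ℤ} (hA : A.det ≠ 0) {f : Plane → ℂ}
    (hf : MemLp f 2 volume) (j : ℕ) (m : Fin 2 → ℤ) : MemLp (atomFun A f j m) 2 volume := by
  have hdet : (powR A j).det ≠ 0 := by
    have h : (powR A j).det = (((A ^ j).det : ℤ) : ℝ) :=
      ((Int.castRingHom ℝ).map_det (A ^ j)).symm
    rw [h, Matrix.det_pow]
    exact_mod_cast pow_ne_zero j hA
  have h1 : MemLp (fun y => f (y - intPt m)) 2 volume :=
    hf.comp_measurePreserving (measurePreserving_sub_right volume (intPt m))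
  have h2 : MemLp (fun y => f (y - intPt m)) 2
      (Measure.map (Matrix.toLin' (powR A j)) (volume : Measure Plane)) := by
    rw [Real.map_matrix_volume_pi_eq_smul_volume_pi hdet]
    exact h1.smul_measure ENNReal.ofReal_ne_top
  have h3 := h2.comp_of_map (Matrix.toLin' (powR A j)).continuous_of_finiteDimensional.aemeasurable
  exact h3.const_mul _

/-- The element `f_{j,m}` of `L²(ℝ²)`. -/
def atom (A : Matrix (Fin 2) (Fin 2) ℤ) (f : Plane → ℂ) (j : ℕ) (m : Fin 2 → ℤ) : L2 :=
  toL2 (atomFun A f j m)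

/-- `(V_j)` is a multiresolution analysis for `A` with scaling function `φ`. -/
structure IsMRA (A : Matrix (Fin 2) (Fin 2) ℤ) (V : ℤ → Submodule ℂ L2) (φ : Plane → ℂ) :
    Prop where
  isClosed : ∀ j, IsClosed (V j : Set L2)
  le_succ : ∀ j, V j ≤ V (j + 1)
  iInf_eq_bot : ⨅ j, V j = ⊥
  closure_iUnion : closure (⋃ j, (V j : Set L2)) = Set.univ
  dilation : ∀ (j : ℤ) (f g : L2),
    (g : Plane → ℂ) =ᵐ[volume] (fun x => f (powR A 1 *ᵥ x)) → (f ∈ V j ↔ g ∈ V (j + 1))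
  memLp : MemLp φ 2 volume
  orthonormal : Orthonormal ℂ (fun m : Fin 2 → ℤ => atom A φ 0 m)
  span_eq : (Submodule.span ℂ (Set.range fun m : Fin 2 → ℤ => atom A φ 0 m)).topologicalClosure
    = V 0

/-- The index type of the `|det A| - 1` wavelets. -/
abbrev WIdx (A : Matrix (Fin 2) (Fin 2) ℤ) : Type := Fin (A.det.natAbs - 1)

/-- For every scale `j ≥ 0`, the functions `ψ^p_{j,m}` form an orthonormal basis of the wavelet
space `W_j`, the orthogonal complement of `V_j` in `V_{j+1}`. -/
structure IsWaveletSystem (A : Matrix (Fin 2) (Fin 2) ℤ) (V : ℤ → Submodule ℂ L2)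
    (ψ : WIdx A → Plane → ℂ) : Prop where
  memLp : ∀ p, MemLp (ψ p) 2 volume
  orthonormal : ∀ j : ℕ,
    Orthonormal ℂ (fun q : WIdx A × (Fin 2 → ℤ) => atom A (ψ q.1) j q.2)
  span_eq : ∀ j : ℕ,
    (Submodule.span ℂ
      (Set.range fun q : WIdx A × (Fin 2 → ℤ) => atom A (ψ q.1) j q.2)).topologicalClosure
    = V ((j : ℤ) + 1) ⊓ (V (j : ℤ))ᗮ

/-- `f` vanishes almost everywhere outside of the square `[u, v]²`. -/
def SupportedIn (f : Plane → ℂ) (u v : ℝ) : Prop :=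
  ∀ᵐ x ∂(volume : Measure Plane), x ∉ Set.Icc (fun _ : Fin 2 => u) (fun _ => v) → f x = 0

/-! ### Reconstruction spaces -/

/-- The translations at scale `j`: all `m` with `-a < m_i < a (A^j_{i1} + A^j_{i2})`. For `j = 0`
these are the `m` with `-a < m_i < a`. -/
def transl (A : Matrix (Fin 2) (Fin 2) ℤ) (a j : ℕ) : Finset (Fin 2 → ℤ) :=
  Fintype.piFinset fun i =>
    Finset.Ioo (-(a : ℤ)) ((a : ℤ) * ((A ^ j) i 0 + (A ^ j) i 1))

/-- The truncated scaling space `V_0^{(a)}`. -/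
def truncV (A : Matrix (Fin 2) (Fin 2) ℤ) (φ : Plane → ℂ) (a : ℕ) : Submodule ℂ L2 :=
  Submodule.span ℂ (Set.range fun m : transl A a 0 => atom A φ 0 m)

/-- The truncated wavelet space `W_j^{(a)}`. -/
def truncW (A : Matrix (Fin 2) (Fin 2) ℤ) (ψ : WIdx A → Plane → ℂ) (a j : ℕ) :
    Submodule ℂ L2 :=
  Submodule.span ℂ (Set.range fun q : WIdx A × transl A a j => atom A (ψ q.1) j q.2)

/-- The reconstruction space up to scale `J - 1`: the sum of `V_0^{(a)}` and of `W_j^{(a)}`,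
`0 ≤ j < J`. -/
def reconSpace (A : Matrix (Fin 2) (Fin 2) ℤ) (φ : Plane → ℂ) (ψ : WIdx A → Plane → ℂ)
    (a J : ℕ) : Submodule ℂ L2 :=
  truncV A φ a ⊔ ⨆ j : Fin J, truncW A ψ a j

/-- The full reconstruction space: the closed linear span over all scales. -/
def reconSpaceFull (A : Matrix (Fin 2) (Fin 2) ℤ) (φ : Plane → ℂ) (ψ : WIdx A → Plane → ℂ)
    (a : ℕ) : Submodule ℂ L2 :=
  (truncV A φ a ⊔ ⨆ j : ℕ, truncW A ψ a j).topologicalClosure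

/-- The number `N_J` of reconstruction elements up to scale `J - 1`. -/
def numRecon (A : Matrix (Fin 2) (Fin 2) ℤ) (a J : ℕ) : ℤ :=
  (2 * (a : ℤ) - 1) ^ 2 + (|A.det| - 1) * ∑ j ∈ Finset.range J,
    ((a : ℤ) * ((A ^ j) 0 0 + (A ^ j) 0 1 + 1) - 1) *
      ((a : ℤ) * ((A ^ j) 1 0 + (A ^ j) 1 1 + 1) - 1)

instance finiteDimensional_truncV (A : Matrix (Fin 2) (Fin 2) ℤ) (φ : Plane → ℂ) (a : ℕ) :
    FiniteDimensional ℂ (truncV A φ a) :=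
  FiniteDimensional.span_of_finite ℂ (Set.finite_range _)

instance finiteDimensional_truncW (A : Matrix (Fin 2) (Fin 2) ℤ) (ψ : WIdx A → Plane → ℂ)
    (a j : ℕ) : FiniteDimensional ℂ (truncW A ψ a j) :=
  FiniteDimensional.span_of_finite ℂ (Set.finite_range _)

instance finiteDimensional_reconSpace (A : Matrix (Fin 2) (Fin 2) ℤ) (φ : Plane → ℂ)
    (ψ : WIdx A → Plane → ℂ) (a J : ℕ) : FiniteDimensional ℂ (reconSpace A φ ψ a J) := by
  unfold reconSpace
  infer_instance

/-! ### Sampling spaces -/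

/-- The function `ε exp(2 π i ε ⟨l, x⟩) χ_{[-T₁, T₂]²}(x)`. -/
def sampFun (T₁ T₂ ε : ℝ) (l : Fin 2 → ℤ) : Plane → ℂ :=
  (Set.Icc (fun _ : Fin 2 => -T₁) (fun _ => T₂)).indicator fun x =>
    (ε : ℂ) * Complex.exp (2 * Real.pi * Complex.I * ε * ((intPt l ⬝ᵥ x : ℝ) : ℂ))

/-- The sampling functions are square integrable. -/
theorem memLp_sampFun (T₁ T₂ ε : ℝ) (l : Fin 2 → ℤ) : MemLp (sampFun T₁ T₂ ε l) 2 volume := by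
  unfold sampFun
  rw [memLp_indicator_iff_restrict measurableSet_Icc]
  have hc : Continuous fun x : Plane =>
      (ε : ℂ) * Complex.exp (2 * Real.pi * Complex.I * ε * ((intPt l ⬝ᵥ x : ℝ) : ℂ)) := by
    unfold dotProduct
    fun_prop
  obtain ⟨C, hC⟩ := (isCompact_Icc (a := fun _ : Fin 2 => -T₁)
    (b := fun _ => T₂)).exists_bound_of_continuousOn hc.continuousOn
  haveI : IsFiniteMeasure
      ((volume : Measure Plane).restrict (Set.Icc (fun _ : Fin 2 => -T₁) (fun _ => T₂))) :=
    ⟨by simpa using isCompact_Icc.measure_lt_top⟩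
  exact MemLp.of_bound hc.aestronglyMeasurable C
    ((ae_restrict_iff' measurableSet_Icc).2 (Eventually.of_forall hC))

/-- The sampling vector `s_l^{(ε)}`. -/
def samp (T₁ T₂ ε : ℝ) (l : Fin 2 → ℤ) : L2 :=
  toL2 (sampFun T₁ T₂ ε l)

/-- The sampling space `S_M^{(ε)}`. -/
def sampSpace (T₁ T₂ ε : ℝ) (M : Fin 2 → ℕ) : Submodule ℂ L2 :=
  Submodule.span ℂ (Set.range fun l : box M => samp T₁ T₂ ε l)

instance finiteDimensional_sampSpace (T₁ T₂ ε : ℝ) (M : Fin 2 → ℕ) :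
    FiniteDimensional ℂ (sampSpace T₁ T₂ ε M) :=
  FiniteDimensional.span_of_finite ℂ (Set.finite_range _)

/-! ### The mesh norm assumption -/

/-- The rectangle `L_M = [-M_1, M_1] × [-M_2, M_2]`. -/
def rect (M : Fin 2 → ℕ) : Set Plane :=
  Set.Icc (fun i => -(M i : ℝ)) (fun i => (M i : ℝ))

/-- The point `ε A^{-J} x`. -/
def contract (A : Matrix (Fin 2) (Fin 2) ℤ) (ε : ℝ) (J : ℕ) (x : Plane) : Plane :=
  ε • ((powR A J)⁻¹ *ᵥ x)

/-- The mesh norm of the nodes `ε A^{-J} l`, `l ∈ I_M`, in `ε A^{-J} (L_M)`: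
`max_{x ∈ ε A^{-J}(L_M)} min_{l ∈ I_M} min_{k ∈ ε A^{-J}(ℤ²)} ‖x - ε A^{-J} l + k‖_∞`. -/
def meshNorm (A : Matrix (Fin 2) (Fin 2) ℤ) (ε : ℝ) (J : ℕ) (M : Fin 2 → ℕ) : ℝ :=
  sSup ((fun x : Plane => sInf {d : ℝ | ∃ l ∈ box M, ∃ k : Fin 2 → ℤ,
      d = ‖x - contract A ε J (intPt l) + contract A ε J (intPt k)‖}) ''
    (contract A ε J '' rect M))

/-- `L_1, L_2, L_3, L_4` are bounds for the representation of the reconstruction space by scaling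
functions at scale `J`: every element of it is a linear combination of the `φ_{J,l}` with
`L_3 ≤ l_1 ≤ L_1` and `L_4 ≤ l_2 ≤ L_2`. -/
def IsRepBound (A : Matrix (Fin 2) (Fin 2) ℤ) (φ : Plane → ℂ) (ψ : WIdx A → Plane → ℂ)
    (a J : ℕ) (L₁ L₂ L₃ L₄ : ℤ) : Prop :=
  ∀ f ∈ reconSpace A φ ψ a J, ∃ α : ℤ → ℤ → ℂ,
    f = ∑ l₁ ∈ Finset.Icc L₃ L₁, ∑ l₂ ∈ Finset.Icc L₄ L₂, α l₁ l₂ • atom A φ J ![l₁, l₂]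

/-- The mesh norm assumption: for some `ε ∈ (0, 1/(T₁+T₂)]` independent of `J` and for all `J ≥ 1`,
with bounds `L_i` for the scale `J` and some `M`,
`δ < log(1/√μ(L_M) + 1) / (4 π max |L_i|)`. -/
def MeshAssumption (A : Matrix (Fin 2) (Fin 2) ℤ) (φ : Plane → ℂ) (ψ : WIdx A → Plane → ℂ)
    (a : ℕ) (T₁ T₂ : ℝ) : Prop :=
  ∃ ε : ℝ, 0 < ε ∧ ε ≤ 1 / (T₁ + T₂) ∧ ∀ J : ℕ, 1 ≤ J →
    ∃ L₁ L₂ L₃ L₄ : ℤ, IsRepBound A φ ψ a J L₁ L₂ L₃ L₄ ∧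
    ∃ M : Fin 2 → ℕ, (∀ i, 1 ≤ M i) ∧
      meshNorm A ε J M <
        Real.log (1 / Real.sqrt (volume (rect M)).toReal + 1) /
          (4 * Real.pi * ((max (max |L₁| |L₂|) (max |L₃| |L₄|) : ℤ) : ℝ))

end GSWavelet

end

/-! Everything rests on one energy estimate, `Captures`: the samples in the box carry all but a
fraction `δ` of `‖f‖²` for every `f` in the reconstruction space. Since `ε⁻¹` is at least the side
of the square, the samples form Fourier coefficients; Parseval gives a Bessel bound `1`. Hilbert
space algebra then yields `cos ω ≥ √(1 - δ)`, the existence of `G_M`, a quasi-optimality constant at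
most `1 + √δ/(1 - δ)` and a condition number at most `1/√(1 - δ)`. All these bounds tend to `1` as
`δ → 0`.

The estimate (`exists_captures`) comes from translations and needs no smoothness of `φ`. On `V_0`,
compact support and orthonormality give `‖f(· + h) - f‖ ≤ c ‖φ(· + h) - φ‖ ‖f‖`, which is small for
small `h` because translation is continuous in `L²`. Dilation carries this to `V_J` with `h`
replaced by `A^{-J} h`. Translation multiplies the sample at `l` by a phase, and averaging over
short segments of `h` along the axes shows that the frequencies with a large coordinate of `ε l
A^{-J}` carry little energy. All `l` outside the box are of this kind, as `A^J` has non-negative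
entries.

In part 2 the mesh norm assumption serves to show that `A` is balanced. By volume, the mesh norm is
at least `ε / (2 |det A|^{J/2})` (`le_meshNorm`). The support of an extreme wavelet at the finest
scale makes `max |L_i|` grow at least like the row sums of `A^J` (`IsRepBound.rowSum_le`). The
assumption bounds the product of the two, so the row sums are `O(|det A|^{J/2})`. Boxes with `O(|det
A|^J)` points then suffice, while `N_J ≥ |det A|^{J-1}`. -/

noncomputable section

namespace GSWavelet

/-! ### Generalized sampling when the samples capture almost all of the energy -/

section Abstract

variable {H : Type*} [NormedAddCommGroup H] [InnerProductSpace ℂ H] {ι : Type*}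

/-- The samples in `I` satisfy a Bessel inequality with bound `1`. -/
def IsBessel (s : ι → H) (I : Finset ι) : Prop :=
  ∀ h : H, ∑ l ∈ I, ‖inner ℂ (s l) h‖ ^ 2 ≤ ‖h‖ ^ 2

/-- The samples in `I` capture the energy of the vectors of `R` up to the fraction `δ`. -/
def Captures (R : Submodule ℂ H) (s : ι → H) (I : Finset ι) (δ : ℝ) : Prop :=
  ∀ r ∈ R, (1 - δ) * ‖r‖ ^ 2 ≤ ∑ l ∈ I, ‖inner ℂ (s l) r‖ ^ 2

theorem sampOp_add (s : ι → H) (I : Finset ι) (f g : H) :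
    sampOp s I (f + g) = sampOp s I f + sampOp s I g := by
  simp [sampOp, add_smul, Finset.sum_add_distrib]

theorem sampOp_smul (s : ι → H) (I : Finset ι) (c : ℂ) (f : H) :
    sampOp s I (c • f) = c • sampOp s I f := by
  simp [sampOp, mul_smul, Finset.smul_sum]

/-- `sampOp` as a linear map. -/
def sampLin (s : ι → H) (I : Finset ι) : H →ₗ[ℂ] H where
  toFun := sampOp s I
  map_add' := sampOp_add s I
  map_smul' := sampOp_smul s I

theorem sampNorm_nonneg (s : ι → H) (I : Finset ι) (g : H) : 0 ≤ sampNorm s I g :=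
  Real.sqrt_nonneg _

theorem sampNorm_sq (s : ι → H) (I : Finset ι) (g : H) :
    sampNorm s I g ^ 2 = ∑ l ∈ I, ‖inner ℂ (s l) g‖ ^ 2 :=
  Real.sq_sqrt (Finset.sum_nonneg fun _ _ => sq_nonneg _)

theorem inner_sampOp (s : ι → H) (I : Finset ι) (f g : H) :
    inner ℂ f (sampOp s I g) = ∑ l ∈ I, inner ℂ (s l) g * inner ℂ f (s l) := by
  simp [sampOp]

theorem inner_sampOp_self (s : ι → H) (I : Finset ι) (g : H) :
    inner ℂ g (sampOp s I g) = ((sampNorm s I g ^ 2 : ℝ) : ℂ) := by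
  rw [inner_sampOp, sampNorm_sq]
  push_cast
  refine Finset.sum_congr rfl fun l _ => ?_
  rw [← inner_conj_symm g (s l), Complex.mul_conj, Complex.normSq_eq_norm_sq]
  push_cast
  rfl

/-- Cauchy–Schwarz in the `ℓ²` space of sample vectors. -/
theorem norm_inner_sampOp_le (s : ι → H) (I : Finset ι) (f g : H) :
    ‖inner ℂ f (sampOp s I g)‖ ≤ sampNorm s I f * sampNorm s I g := by
  rw [inner_sampOp]
  refine (norm_sum_le _ _).trans ?_
  have h := Finset.sum_mul_sq_le_sq_mul_sq I (fun l => ‖inner ℂ (s l) g‖)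
    (fun l => ‖inner ℂ (s l) f‖)
  rw [← sampNorm_sq, ← sampNorm_sq, ← mul_pow] at h
  have h' := abs_le_of_sq_le_sq' h (mul_nonneg (sampNorm_nonneg s I g) (sampNorm_nonneg s I f))
  calc ∑ l ∈ I, ‖inner ℂ (s l) g * inner ℂ f (s l)‖
      = ∑ l ∈ I, ‖inner ℂ (s l) g‖ * ‖inner ℂ (s l) f‖ := by
        refine Finset.sum_congr rfl fun l _ => ?_
        rw [norm_mul, norm_inner_symm f]
    _ ≤ sampNorm s I f * sampNorm s I g := by linarith [h'.2]

theorem inner_sampOp_symm (s : ι → H) (I : Finset ι) (f g : H) :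
    inner ℂ (sampOp s I f) g = inner ℂ f (sampOp s I g) := by
  rw [inner_sampOp, ← inner_conj_symm, inner_sampOp, map_sum]
  refine Finset.sum_congr rfl fun l _ => ?_
  rw [map_mul, inner_conj_symm, inner_conj_symm, mul_comm]

variable {s : ι → H} {I : Finset ι} {R : Submodule ℂ H} {δ : ℝ}

theorem IsBessel.sampNorm_le (hB : IsBessel s I) (h : H) : sampNorm s I h ≤ ‖h‖ := by
  refine abs_le_of_sq_le_sq' ?_ (norm_nonneg h) |>.2
  rw [sampNorm_sq]
  exact hB h

/-- With `Q = sampOp s I`, pair `Q h` with itself: `‖Q h‖² ≤ sampNorm (Q h) * sampNorm h`, and the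
first factor is at most `‖Q h‖`. -/
theorem IsBessel.norm_sampOp_le (hB : IsBessel s I) (h : H) :
    ‖sampOp s I h‖ ≤ sampNorm s I h := by
  have h1 := norm_inner_sampOp_le s I (sampOp s I h) h
  have h2 : ‖inner ℂ (sampOp s I h) (sampOp s I h)‖ = ‖sampOp s I h‖ ^ 2 := by
    rw [inner_self_eq_norm_sq_to_K]; simp
  rw [h2] at h1
  have h3 := hB.sampNorm_le (sampOp s I h)
  have h4 := sampNorm_nonneg s I h
  rcases (norm_nonneg (sampOp s I h)).eq_or_lt with h0 | h0
  · rw [← h0]; exact h4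
  · nlinarith

theorem Captures.sampNorm_sq_ge (hC : Captures R s I δ) {r : H} (hr : r ∈ R) :
    (1 - δ) * ‖r‖ ^ 2 ≤ sampNorm s I r ^ 2 := by
  rw [sampNorm_sq]; exact hC r hr

/-- Expanding the square gives `‖r‖² - 2 sampNorm² + ‖Q r‖² ≤ ‖r‖² - sampNorm²`: the frame operator
is almost the identity on `R`. -/
theorem Captures.norm_sub_sampOp_le (hB : IsBessel s I) (hC : Captures R s I δ) (hδ : 0 ≤ δ)
    {r : H} (hr : r ∈ R) : ‖sampOp s I r - r‖ ≤ √δ * ‖r‖ := by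
  refine abs_le_of_sq_le_sq' ?_ (by positivity) |>.2
  rw [mul_pow, Real.sq_sqrt hδ, norm_sub_rev, norm_sub_sq (𝕜 := ℂ), inner_sampOp_self]
  have h1 := hC.sampNorm_sq_ge hr
  have h2 := pow_le_pow_left₀ (norm_nonneg _) (hB.norm_sampOp_le r) 2
  have h3 : RCLike.re (((sampNorm s I r ^ 2 : ℝ) : ℂ)) = sampNorm s I r ^ 2 := Complex.ofReal_re _
  rw [h3]
  linarith

/-- As `Q u ∈ U`, `sampNorm u ^ 2 = ⟨P_U u, Q u⟩ ≤ ‖P_U u‖ * sampNorm u`. The unit vector in `R` is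
needed because the real infimum over the empty set is `0`. -/
theorem Captures.le_cosAngle {U : Submodule ℂ H} [U.HasOrthogonalProjection]
    (hB : IsBessel s I) (hC : Captures R s I δ) (hU : ∀ l ∈ I, s l ∈ U)
    (hR : ∃ u ∈ R, ‖u‖ = 1) : √(1 - δ) ≤ cosAngle R U := by
  obtain ⟨u₀, hu₀, hn₀⟩ := hR
  refine le_csInf ⟨_, u₀, hu₀, hn₀, rfl⟩ ?_
  rintro _ ⟨u, hu, hn, rfl⟩
  have hQ : sampOp s I u ∈ U := U.sum_mem fun l hl => U.smul_mem _ (hU l hl)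
  have h1 : inner ℂ (U.starProjection u) (sampOp s I u) = ((sampNorm s I u ^ 2 : ℝ) : ℂ) := by
    rw [← inner_sampOp_self, Submodule.inner_starProjection_left_eq_right,
      Submodule.starProjection_eq_self_iff.2 hQ]
  have h2 := norm_inner_le_norm (𝕜 := ℂ) (U.starProjection u) (sampOp s I u)
  rw [h1, Complex.norm_real, Real.norm_eq_abs, abs_of_nonneg (sq_nonneg _)] at h2
  have h3 := hB.norm_sampOp_le u
  have h4 := hC.sampNorm_sq_ge hu
  rw [hn, one_pow, mul_one] at h4
  have h5 := sampNorm_nonneg s I u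
  have h6 : sampNorm s I u ≤ ‖U.starProjection u‖ := by
    rcases h5.eq_or_lt with h0 | h0
    · rw [← h0]; exact norm_nonneg _
    · nlinarith [norm_nonneg (U.starProjection u)]
  refine le_trans ?_ h6
  rw [← Real.sqrt_sq h5]
  exact Real.sqrt_le_sqrt h4

theorem Captures.eq_zero_of_inner (hC : Captures R s I δ) (hδ : δ < 1) {g : H} (hg : g ∈ R)
    (h : ∀ r ∈ R, inner ℂ r (sampOp s I g) = 0) : g = 0 := by
  have h1 := h g hg
  rw [inner_sampOp_self] at h1
  have h2 : sampNorm s I g ^ 2 = 0 := by exact_mod_cast h1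
  have h3 := hC.sampNorm_sq_ge hg
  rw [h2] at h3
  have : ‖g‖ ^ 2 ≤ 0 := by nlinarith [sq_nonneg ‖g‖]
  exact norm_eq_zero.1 (pow_eq_zero_iff two_ne_zero |>.1 (le_antisymm this (sq_nonneg _)))

/-- The compression of `Q` to `R` is injective, hence bijective in finite dimension. -/
theorem Captures.exists_isGenSampling [FiniteDimensional ℂ R]
    (hC : Captures R s I δ) (hδ : δ < 1) : ∃ G : H → H, IsGenSampling R s I G := by
  let T : R →ₗ[ℂ] R := (R.orthogonalProjectionOnto : H →ₗ[ℂ] R) ∘ₗ sampLin s I ∘ₗ R.subtype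
  have hin : ∀ (r : H) (_ : r ∈ R) (x : H),
      inner ℂ r (R.orthogonalProjectionOnto x : H) = inner ℂ r x := by
    intro r hr x
    have := Submodule.inner_starProjection_left_eq_right R r x
    rw [Submodule.starProjection_eq_self_iff.2 hr] at this
    rw [this]; rfl
  have hT : Function.Injective T := by
    refine (injective_iff_map_eq_zero T).2 fun g hg => ?_
    refine Subtype.ext (hC.eq_zero_of_inner hδ g.2 fun r hr => ?_)
    rw [← hin r hr]
    change inner ℂ r ((T g : R) : H) = 0
    rw [hg]; simp
  have hS := LinearMap.injective_iff_surjective.1 hT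
  choose G hG using fun f : H => hS (R.orthogonalProjectionOnto (sampOp s I f))
  have key : ∀ f, ∀ r ∈ R, inner ℂ r (sampOp s I (G f)) = inner ℂ r (sampOp s I f) := by
    intro f r hr
    rw [← hin r hr (sampOp s I f), ← hG f]
    exact (hin r hr _).symm
  refine ⟨fun f => G f, fun f g => ⟨?_, ?_⟩⟩
  · rintro ⟨hg, hr⟩
    refine sub_eq_zero.1 (hC.eq_zero_of_inner hδ (R.sub_mem hg (G f).2) fun r hrR => ?_)
    change inner ℂ r (sampLin s I (g - G f)) = 0
    rw [map_sub, inner_sub_right]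
    change inner ℂ r (sampOp s I g) - inner ℂ r (sampOp s I (G f)) = 0
    rw [hr r hrR, key f r hrR, sub_self]
  · rintro rfl
    exact ⟨(G f).2, key f⟩

theorem IsGenSampling.mem {G : H → H} (hG : IsGenSampling R s I G) (f : H) : G f ∈ R :=
  ((hG f (G f)).2 rfl).1

theorem IsGenSampling.inner_eq {G : H → H} (hG : IsGenSampling R s I G) (f : H) {r : H}
    (hr : r ∈ R) : inner ℂ r (sampOp s I (G f)) = inner ℂ r (sampOp s I f) :=
  ((hG f (G f)).2 rfl).2 r hr

theorem IsGenSampling.map_add {G : H → H} (hG : IsGenSampling R s I G) (f g : H) :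
    G (f + g) = G f + G g := by
  refine ((hG (f + g) (G f + G g)).1 ⟨R.add_mem (hG.mem f) (hG.mem g), fun r hr => ?_⟩).symm
  rw [sampOp_add, sampOp_add, inner_add_right, inner_add_right, hG.inner_eq f hr,
    hG.inner_eq g hr]

theorem IsGenSampling.apply_of_mem {G : H → H} (hG : IsGenSampling R s I G) {f : H}
    (hf : f ∈ R) : G f = f :=
  ((hG f f).1 ⟨hf, fun _ _ => rfl⟩).symm

/-- Test the defining equation with `r = G g` and apply Cauchy–Schwarz. -/
theorem IsGenSampling.sampNorm_le {G : H → H} (hG : IsGenSampling R s I G) (g : H) :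
    sampNorm s I (G g) ≤ sampNorm s I g := by
  have h1 := hG.inner_eq g (hG.mem g)
  have h2 := norm_inner_sampOp_le s I (G g) g
  rw [← h1, inner_sampOp_self, Complex.norm_real, Real.norm_eq_abs,
    abs_of_nonneg (sq_nonneg _)] at h2
  rcases (sampNorm_nonneg s I (G g)).eq_or_lt with h0 | h0
  · rw [← h0]; exact sampNorm_nonneg _ _ _
  · nlinarith

theorem IsGenSampling.norm_le {G : H → H} (hG : IsGenSampling R s I G)
    (hC : Captures R s I δ) (hδ : δ < 1) (g : H) : ‖G g‖ ≤ sampNorm s I g / √(1 - δ) := by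
  have hδ' : 0 < 1 - δ := by linarith
  rw [le_div_iff₀ (Real.sqrt_pos.2 hδ')]
  refine le_trans ?_ (hG.sampNorm_le g)
  refine abs_le_of_sq_le_sq' ?_ (sampNorm_nonneg _ _ _) |>.2
  rw [mul_pow, Real.sq_sqrt hδ'.le]
  linarith [hC.sampNorm_sq_ge (hG.mem g)]

/-- Since `⟨G e, e⟩ = 0`, the energy of the samples of `G e` equals `⟨Q (G e) - G e, e⟩`, where `Q`
is almost the identity. This gains the factor `√δ` that brings the quasi-optimality constant close
to `1`. -/
theorem IsGenSampling.norm_le_of_mem_orthogonal {G : H → H} (hG : IsGenSampling R s I G)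
    (hB : IsBessel s I) (hC : Captures R s I δ) (hδ0 : 0 ≤ δ) (hδ : δ < 1) {e : H}
    (he : e ∈ Rᗮ) : ‖G e‖ ≤ √δ / (1 - δ) * ‖e‖ := by
  have hδ' : 0 < 1 - δ := by linarith
  have h1 : ((sampNorm s I (G e) ^ 2 : ℝ) : ℂ) = inner ℂ (sampOp s I (G e) - G e) e := by
    rw [inner_sub_left, (R.mem_orthogonal e).1 he _ (hG.mem e), sub_zero, inner_sampOp_symm,
      ← hG.inner_eq e (hG.mem e), inner_sampOp_self]
  have h2 := norm_inner_le_norm (𝕜 := ℂ) (sampOp s I (G e) - G e) e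
  rw [← h1, Complex.norm_real, Real.norm_eq_abs, abs_of_nonneg (sq_nonneg _)] at h2
  have h3 := hC.norm_sub_sampOp_le hB hδ0 (hG.mem e)
  have h4 := hC.sampNorm_sq_ge (hG.mem e)
  have h5 : (1 - δ) * ‖G e‖ ^ 2 ≤ √δ * ‖G e‖ * ‖e‖ :=
    h4.trans (h2.trans (mul_le_mul_of_nonneg_right h3 (norm_nonneg _)))
  rw [div_mul_eq_mul_div, le_div_iff₀ hδ']
  rcases (norm_nonneg (G e)).eq_or_lt with h0 | h0
  · rw [← h0]; simp; positivity
  · nlinarith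

theorem IsGenSampling.quasiOpt_le [R.HasOrthogonalProjection] {G : H → H}
    (hG : IsGenSampling R s I G) (hB : IsBessel s I) (hC : Captures R s I δ) (hδ0 : 0 ≤ δ)
    (hδ : δ < 1) : quasiOpt R G ≤ ENNReal.ofReal (1 + √δ / (1 - δ)) := by
  have hδ' : 0 < 1 - δ := by linarith
  refine sInf_le fun f => ?_
  rw [← ENNReal.ofReal_mul (by positivity)]
  refine ENNReal.ofReal_le_ofReal ?_
  set e := f - R.starProjection f with he
  have heo : e ∈ Rᗮ := R.sub_starProjection_mem_orthogonal f
  have hf : f = R.starProjection f + e := by simp [he]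
  have hGf : G f = R.starProjection f + G e := by
    conv_lhs => rw [hf, hG.map_add, hG.apply_of_mem (R.starProjection_apply_mem f)]
  have : f - G f = e - G e := by rw [hGf, he]; abel
  rw [this, add_mul, one_mul]
  exact (norm_sub_le _ _).trans
    (add_le_add le_rfl (hG.norm_le_of_mem_orthogonal hB hC hδ0 hδ heo))

/-- By additivity the difference quotient depends neither on `f` nor on the scale of `g`, so `η = 1`
suffices. -/
theorem IsGenSampling.condNumber_le {G : H → H} (hG : IsGenSampling R s I G)
    (hC : Captures R s I δ) (hδ : δ < 1) :
    condNumber s I G ≤ ENNReal.ofReal (1 / √(1 - δ)) := by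
  refine iSup_le fun f => (iInf₂_le (1 : ℝ) one_pos).trans (iSup₂_le fun g hg => ?_)
  refine ENNReal.ofReal_le_ofReal ?_
  rw [hG.map_add, add_sub_cancel_left, div_le_iff₀ hg.1]
  have := hG.norm_le hC hδ g
  rwa [one_div, inv_mul_eq_div]

theorem exists_capture_threshold {θ : ℝ} (hθ : 1 < θ) :
    ∃ δ : ℝ, 0 < δ ∧ δ < 1 ∧ 1 + √δ / (1 - δ) < θ ∧ 1 / √(1 - δ) < θ := by
  have h1 : Tendsto (fun δ : ℝ => 1 + √δ / (1 - δ)) (nhdsWithin 0 (Set.Ioi 0)) (nhds 1) := by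
    have : ContinuousAt (fun δ : ℝ => 1 + √δ / (1 - δ)) 0 := by
      apply ContinuousAt.add continuousAt_const
      apply ContinuousAt.div (by fun_prop) (by fun_prop); norm_num
    simpa using this.tendsto.mono_left nhdsWithin_le_nhds
  have h2 : Tendsto (fun δ : ℝ => 1 / √(1 - δ)) (nhdsWithin 0 (Set.Ioi 0)) (nhds 1) := by
    have : ContinuousAt (fun δ : ℝ => 1 / √(1 - δ)) 0 := by
      apply ContinuousAt.div (by fun_prop) (by fun_prop); norm_num
    simpa using this.tendsto.mono_left nhdsWithin_le_nhds
  have h3 : ∀ᶠ δ : ℝ in nhdsWithin 0 (Set.Ioi 0), δ < 1 :=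
    nhdsWithin_le_nhds (eventually_lt_nhds one_pos)
  obtain ⟨δ, ⟨⟨ha, hb⟩, hc⟩, hd⟩ := (((h1.eventually_lt_const hθ).and
    (h2.eventually_lt_const hθ)).and h3 |>.and self_mem_nhdsWithin).exists
  exact ⟨δ, hd, hc, ha, hb⟩

/-- If enough energy is captured, generalized sampling exists with a small reconstruction
constant. -/
theorem Captures.exists_recConst_lt [FiniteDimensional ℂ R] {θ : ℝ}
    (hB : IsBessel s I) (hC : Captures R s I δ) (hδ0 : 0 ≤ δ) (hδ : δ < 1)
    (h1 : 1 + √δ / (1 - δ) < θ) (h2 : 1 / √(1 - δ) < θ) :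
    ∃ G : H → H, IsGenSampling R s I G ∧ recConst R s I G < ENNReal.ofReal θ := by
  obtain ⟨G, hG⟩ := hC.exists_isGenSampling hδ
  have hθ : 0 < θ := lt_of_le_of_lt (by positivity) h2
  refine ⟨G, hG, max_lt ((hG.quasiOpt_le hB hC hδ0 hδ).trans_lt ?_)
    ((hG.condNumber_le hC hδ).trans_lt ?_)⟩
  · exact (ENNReal.ofReal_lt_ofReal_iff hθ).2 h1
  · exact (ENNReal.ofReal_lt_ofReal_iff hθ).2 h2

end Abstract

/-! ### Parseval's identity on a box of side `ε⁻¹` -/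

section Fourier

open UnitAddTorus
open scoped ComplexConjugate

/-- The exponential `exp (2 π i ε ⟨l, x⟩)`. -/
def expFun (ε : ℝ) (l : Fin 2 → ℤ) (x : Plane) : ℂ :=
  Complex.exp (2 * Real.pi * Complex.I * ε * ((intPt l ⬝ᵥ x : ℝ) : ℂ))

/-- The Fourier sample `ε ∫ exp (- 2 π i ε ⟨l, x⟩) u(x) dx`. -/
def fourierSample (ε : ℝ) (l : Fin 2 → ℤ) (u : Plane → ℂ) : ℂ :=
  ε * ∫ x, conj (expFun ε l x) * u x

theorem expFun_eq (ε : ℝ) (l : Fin 2 → ℤ) (x : Plane) :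
    expFun ε l x = Complex.exp (((2 * Real.pi * ε * (intPt l ⬝ᵥ x) : ℝ) : ℂ) * Complex.I) := by
  unfold expFun
  push_cast
  ring_nf

theorem norm_expFun (ε : ℝ) (l : Fin 2 → ℤ) (x : Plane) : ‖expFun ε l x‖ = 1 := by
  rw [expFun_eq, Complex.norm_exp_ofReal_mul_I]

theorem expFun_add (ε : ℝ) (l : Fin 2 → ℤ) (x y : Plane) :
    expFun ε l (x + y) = expFun ε l x * expFun ε l y := by
  unfold expFun
  rw [dotProduct_add, ← Complex.exp_add]
  push_cast
  ring_nf

theorem continuous_expFun (ε : ℝ) (l : Fin 2 → ℤ) : Continuous (expFun ε l) := by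
  unfold expFun dotProduct
  fun_prop

theorem expFun_smul (ε c : ℝ) (l : Fin 2 → ℤ) (x : Plane) :
    expFun ε l (c • x) = expFun (ε * c) l x := by
  unfold expFun
  rw [dotProduct_smul]
  push_cast
  rw [smul_eq_mul]
  push_cast
  ring_nf

theorem mFourier_coe (l : Fin 2 → ℤ) (y : Plane) :
    mFourier l (fun i => (y i : UnitAddCircle)) = expFun 1 l y := by
  simp only [mFourier, ContinuousMap.coe_mk, Fin.prod_univ_two, fourier_coe_apply, expFun,
    dotProduct, Fin.sum_univ_two, intPt, ← Complex.exp_add]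
  congr 1
  push_cast
  ring

/-- The box with lower corner `w` and side `p`. -/
def cube (w : Plane) (p : ℝ) : Set Plane := {x | ∀ i, x i ∈ Set.Ioc (w i) (w i + p)}

theorem measurableSet_cube (w : Plane) (p : ℝ) : MeasurableSet (cube w p) :=
  MeasurableSet.univ_pi' fun _ => measurableSet_Ioc

theorem integral_comp_affine {E : Type*} [NormedAddCommGroup E] [NormedSpace ℝ E] (ε : ℝ)
    (w : Plane) (G : Plane → E) :
    ∫ y, G (w + ε⁻¹ • y) = (ε ^ 2) • ∫ x, G x := by
  rw [Measure.integral_comp_smul volume (fun z => G (w + z)) ε⁻¹,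
    integral_add_left_eq_self G w]
  congr 1
  simp

theorem memLp_comp_affine {ε : ℝ} (hε : 0 < ε) (w : Plane) {u : Plane → ℂ}
    (hu : MemLp u 2 volume) : MemLp (fun y => u (w + ε⁻¹ • y)) 2 volume := by
  have h1 : MemLp (fun z => u (w + z)) 2 volume :=
    hu.comp_measurePreserving (measurePreserving_add_left volume w)
  have h2 : MemLp (fun z => u (w + z)) 2
      (Measure.map (fun y : Plane => ε⁻¹ • y) (volume : Measure Plane)) := by
    rw [Measure.map_addHaar_smul volume (inv_ne_zero hε.ne')]
    exact h1.smul_measure ENNReal.ofReal_ne_top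
  exact h2.comp_of_map (by fun_prop)

-- Total mass `1` on the circle, the normalisation used for the Fourier coefficients.
local instance : MeasureSpace UnitAddCircle := ⟨AddCircle.haarAddCircle⟩

/-- Rescaling the box to the unit torus multiplies both the energy and the squared coefficients by
`ε ^ 2`, so Parseval on the torus transfers. -/
theorem hasSum_fourierSample_of_forall {ε : ℝ} (hε : 0 < ε) (w : Plane) {u : Plane → ℂ}
    (hu : MemLp u 2 volume) (h0 : ∀ x ∉ cube w ε⁻¹, u x = 0) :
    HasSum (fun l : Fin 2 → ℤ => ‖fourierSample ε l u‖ ^ 2) (∫ x, ‖u x‖ ^ 2) := by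
  set v : Plane → ℂ := fun y => u (w + ε⁻¹ • y) with hv
  have hvm : MemLp v 2 volume := memLp_comp_affine hε w hu
  have hv0 : ∀ y ∉ {x : Plane | ∀ i, x i ∈ Set.Ioc ((0 : Plane) i) ((0 : Plane) i + 1)},
      v y = 0 := by
    intro y hy
    refine h0 _ fun h => hy fun i => ?_
    have := h i
    simp only [Pi.add_apply, Pi.smul_apply, smul_eq_mul, Set.mem_Ioc, lt_add_iff_pos_right,
      add_le_add_iff_left] at this
    simp only [Pi.zero_apply, zero_add, Set.mem_Ioc]
    have hi : 0 < ε⁻¹ := inv_pos.2 hε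
    exact ⟨pos_of_mul_pos_right this.1 hi.le, by
      have := this.2; nlinarith⟩
  set F : UnitAddTorus (Fin 2) → ℂ := fun z => v (measurableEquivPiIoc (0 : Plane) z).1 with hF
  have hFv : ∀ y ∈ {x : Plane | ∀ i, x i ∈ Set.Ioc ((0 : Plane) i) ((0 : Plane) i + 1)},
      F (fun i => (y i : UnitAddCircle)) = v y := by
    intro y hy
    have : measurableEquivPiIoc (0 : Plane) (fun i => (y i : UnitAddCircle)) = ⟨y, hy⟩ := by
      rw [← MeasurableEquiv.eq_symm_apply]
      rfl
    rw [hF]; simp only [this]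
  have hms : MeasurableSet
      {x : Plane | ∀ i, x i ∈ Set.Ioc ((0 : Plane) i) ((0 : Plane) i + 1)} :=
    MeasurableSet.univ_pi' fun _ => measurableSet_Ioc
  have hFm : MemLp F 2 volume := by
    have h1 : MemLp (fun y : {x : Plane // ∀ i, x i ∈ Set.Ioc ((0 : Plane) i) ((0 : Plane) i + 1)} =>
        v y.1) 2 (Measure.comap Subtype.val volume) := by
      refine (hvm.restrict _).comp_measurePreserving
        (⟨measurable_subtype_coe, map_comap_subtype_coe hms volume⟩)
    exact h1.comp_measurePreserving (measurePreserving_equivPiIoc (0 : Plane))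
  have hP := hasSum_sq_mFourierCoeff (hFm.toLp F)
  have hnorm : ∫ t, ‖(hFm.toLp F) t‖ ^ 2 = ε ^ 2 * ∫ x, ‖u x‖ ^ 2 := by
    have : ∫ t, ‖(hFm.toLp F) t‖ ^ 2 = ∫ t, ‖F t‖ ^ 2 := by
      refine integral_congr_ae ?_
      filter_upwards [hFm.coeFn_toLp] with t ht
      rw [ht]
    rw [this, integral_preimage (fun t => ‖F t‖ ^ 2) (0 : Plane),
      setIntegral_congr_fun hms (g := fun y => ‖v y‖ ^ 2) (fun y hy => by
        simp only [hFv y hy]),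
      setIntegral_eq_integral_of_forall_compl_eq_zero (fun y hy => by rw [hv0 y hy]; simp),
      integral_comp_affine ε w (fun x => ‖u x‖ ^ 2), smul_eq_mul]
  have hcoef : ∀ l, ‖mFourierCoeff (hFm.toLp F) l‖ ^ 2 = ε ^ 2 * ‖fourierSample ε l u‖ ^ 2 := by
    intro l
    have h1 : mFourierCoeff (hFm.toLp F) l = mFourierCoeff F l := by
      refine integral_congr_ae ?_
      filter_upwards [hFm.coeFn_toLp] with t ht
      rw [ht]
    -- The corner `w` contributes only a unimodular phase.
    have h2 : ∀ y : Plane, conj (expFun 1 l y) * v y =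
        (fun x => expFun ε l w * (conj (expFun ε l x) * u x)) (w + ε⁻¹ • y) := by
      intro y
      simp only [hv]
      rw [expFun_add, expFun_smul, mul_inv_cancel₀ hε.ne', map_mul, ← mul_assoc, ← mul_assoc,
        Complex.mul_conj, Complex.normSq_eq_norm_sq, norm_expFun]
      simp
    rw [h1, mFourierCoeff_eq_integral F l (0 : Plane),
      setIntegral_congr_fun hms (g := fun y => conj (expFun 1 l y) * v y) (fun y hy => by
        simp only [hFv y hy, mFourier_neg, mFourier_coe, smul_eq_mul]),
      setIntegral_eq_integral_of_forall_compl_eq_zero (fun y hy => by rw [hv0 y hy]; simp)]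
    rw [integral_congr_ae (Eventually.of_forall h2), integral_comp_affine ε w
        (fun x => expFun ε l w * (conj (expFun ε l x) * u x)), integral_const_mul, fourierSample, norm_smul, norm_mul, norm_mul,
      norm_expFun, Complex.norm_real, Real.norm_eq_abs, Real.norm_eq_abs, abs_of_pos hε,
      abs_of_nonneg (sq_nonneg ε)]
    ring
  simp_rw [hnorm, hcoef] at hP
  have hε2 : ε ^ 2 ≠ 0 := by positivity
  have h := hP.mul_left (ε ^ 2)⁻¹
  simp only [inv_mul_cancel_left₀ hε2] at h
  exact h

theorem fourierSample_congr_ae {ε : ℝ} {l : Fin 2 → ℤ} {u v : Plane → ℂ} (h : u =ᵐ[volume] v) :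
    fourierSample ε l u = fourierSample ε l v := by
  unfold fourierSample
  congr 1
  refine integral_congr_ae ?_
  filter_upwards [h] with x hx
  rw [hx]

/-- **Parseval's identity** for square integrable functions supported in a box of side `ε⁻¹`. -/
theorem hasSum_fourierSample {ε : ℝ} (hε : 0 < ε) (w : Plane) {u : Plane → ℂ}
    (hu : MemLp u 2 volume) (h0 : ∀ᵐ x, x ∉ cube w ε⁻¹ → u x = 0) :
    HasSum (fun l : Fin 2 → ℤ => ‖fourierSample ε l u‖ ^ 2) (∫ x, ‖u x‖ ^ 2) := by
  have h1 : u =ᵐ[volume] (cube w ε⁻¹).indicator u := by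
    filter_upwards [h0] with x hx
    by_cases h : x ∈ cube w ε⁻¹
    · rw [Set.indicator_of_mem h]
    · rw [Set.indicator_of_notMem h, hx h]
  have h2 := hasSum_fourierSample_of_forall hε w (hu.indicator (measurableSet_cube w ε⁻¹))
    (fun x hx => Set.indicator_of_notMem hx u)
  have h3 : ∫ x, ‖u x‖ ^ 2 = ∫ x, ‖(cube w ε⁻¹).indicator u x‖ ^ 2 := by
    refine integral_congr_ae ?_
    filter_upwards [h1] with x hx
    rw [← hx]
  simp_rw [h3, fourierSample_congr_ae h1]
  exact h2

end Fourier

/-! ### Translations and the Bessel property of the samples -/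

section Sampling

open scoped ComplexConjugate

theorem norm_sq_eq_integral (f : L2) : ‖f‖ ^ 2 = ∫ x, ‖f x‖ ^ 2 := by
  have h1 := inner_self_eq_norm_sq_to_K (𝕜 := ℂ) f
  rw [MeasureTheory.L2.inner_def] at h1
  simp_rw [inner_self_eq_norm_sq_to_K] at h1
  have h2 : ∫ x, ((‖f x‖ : ℂ)) ^ 2 = ((∫ x, ‖f x‖ ^ 2 : ℝ) : ℂ) := by
    rw [← integral_complex_ofReal]
    push_cast
    rfl
  have h3 : ((‖f‖ ^ 2 : ℝ) : ℂ) = ((∫ x, ‖f x‖ ^ 2 : ℝ) : ℂ) := by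
    rw [← h2]
    push_cast
    exact h1.symm
  exact_mod_cast h3

theorem coeFn_toL2 {f : Plane → ℂ} (hf : MemLp f 2 volume) : toL2 f =ᵐ[volume] f := by
  rw [toL2, dif_pos hf]
  exact hf.coeFn_toLp

/-- The translation `f ↦ f(· + h)`. -/
def trans (h : Plane) : L2 →ₗᵢ[ℂ] L2 :=
  Lp.compMeasurePreservingₗᵢ ℂ (fun x => x + h) (measurePreserving_add_right volume h)

theorem coeFn_trans (h : Plane) (f : L2) : trans h f =ᵐ[volume] fun x => f (x + h) :=
  Lp.coeFn_compMeasurePreserving f (measurePreserving_add_right volume h)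

theorem ae_comp_add {p : Plane → Prop} (h : Plane) (hp : ∀ᵐ x, p x) :
    ∀ᵐ x : Plane, p (x + h) :=
  (measurePreserving_add_right volume h).quasiMeasurePreserving.ae hp

theorem fourierSample_sub {ε : ℝ} {l : Fin 2 → ℤ} {u v : Plane → ℂ} (hu : Integrable u)
    (hv : Integrable v) :
    fourierSample ε l (u - v) = fourierSample ε l u - fourierSample ε l v := by
  have h : ∀ {u : Plane → ℂ}, Integrable u → Integrable fun x => conj (expFun ε l x) * u x := by
    intro u hu
    refine hu.bdd_mul (c := 1) ?_ (Eventually.of_forall fun x => ?_)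
    · exact ((Complex.continuous_conj.comp (continuous_expFun ε l))).aestronglyMeasurable
    · rw [RCLike.norm_conj, norm_expFun]
  unfold fourierSample
  rw [← mul_sub, ← integral_sub (h hu) (h hv)]
  simp [mul_sub]

theorem fourierSample_comp_add (ε : ℝ) (l : Fin 2 → ℤ) (t : Plane) (u : Plane → ℂ) :
    fourierSample ε l (fun x => u (x + t)) = expFun ε l t * fourierSample ε l u := by
  unfold fourierSample
  rw [← integral_add_right_eq_self (fun x => conj (expFun ε l x) * u x) t, mul_left_comm]
  congr 1
  rw [← integral_const_mul]
  congr 1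
  funext x
  rw [expFun_add, map_mul, ← mul_assoc, ← mul_assoc, mul_comm (expFun ε l t), mul_assoc (conj _),
    Complex.mul_conj, Complex.normSq_eq_norm_sq, norm_expFun]
  simp

/-- The frequency `ε l` lies on the three times finer grid; the factor `3` comes from the
normalisation by `ε`. -/
theorem fourierSample_three (ε : ℝ) (l : Fin 2 → ℤ) (u : Plane → ℂ) :
    fourierSample ε l u = 3 * fourierSample (ε / 3) (3 • l) u := by
  have : ∀ x, expFun (ε / 3) (3 • l) x = expFun ε l x := by
    intro x
    have h : intPt (3 • l) = (3 : ℝ) • intPt l := by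
      funext i; simp [intPt]
    unfold expFun
    rw [h, smul_dotProduct]
    push_cast
    rw [smul_eq_mul]
    push_cast
    ring_nf
  unfold fourierSample
  simp_rw [this]
  push_cast
  ring

/-- A translation difference is supported in an enlarged square. -/
theorem SupportedIn.trans_sub {f : L2} {u v : ℝ} (hf : SupportedIn f u v) {h : Plane}
    {r : ℝ} (hh : ∀ i, |h i| ≤ r) : SupportedIn (trans h f - f : L2) (u - r) (v + r) := by
  have hr : 0 ≤ r := (abs_nonneg _).trans (hh 0)
  filter_upwards [Lp.coeFn_sub (trans h f) f, coeFn_trans h f, hf, ae_comp_add h hf]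
    with x h1 h4 h2 h3 hx
  have hx1 : x ∉ Set.Icc (fun _ : Fin 2 => u) (fun _ => v) := fun h => hx
    ⟨fun i => by have := h.1 i; simp only at *; linarith,
      fun i => by have := h.2 i; simp only at *; linarith⟩
  have hx2 : x + h ∉ Set.Icc (fun _ : Fin 2 => u) (fun _ => v) := by
    intro h
    refine hx ⟨fun i => ?_, fun i => ?_⟩
    · have := h.1 i; have := abs_le.1 (hh i); simp only [Pi.add_apply] at *; linarith
    · have := h.2 i; have := abs_le.1 (hh i); simp only [Pi.add_apply] at *; linarith
  rw [h1, Pi.sub_apply, h4, h2 hx1, h3 hx2, sub_zero]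

theorem SupportedIn.integrable {f : L2} {u v : ℝ} (hf : SupportedIn f u v) :
    Integrable f := by
  have h1 : (f : Plane → ℂ) =ᵐ[volume] (Set.Icc (fun _ : Fin 2 => u) (fun _ => v)).indicator f := by
    filter_upwards [hf] with x hx
    by_cases h : x ∈ Set.Icc (fun _ : Fin 2 => u) (fun _ => v)
    · rw [Set.indicator_of_mem h]
    · rw [Set.indicator_of_notMem h, hx h]
  rw [integrable_congr h1, integrable_indicator_iff measurableSet_Icc]
  have : IsFiniteMeasure
      ((volume : Measure Plane).restrict (Set.Icc (fun _ : Fin 2 => u) (fun _ => v))) :=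
    ⟨by simpa using isCompact_Icc.measure_lt_top⟩
  exact ((Lp.memLp f).restrict _).integrable (by norm_num)

theorem ae_mem_cube_of_mem_Icc (u v p : ℝ) (hp : v - u ≤ p) :
    ∀ᵐ x : Plane, x ∈ Set.Icc (fun _ : Fin 2 => u) (fun _ => v) → x ∈ cube (fun _ => u) p := by
  have h := Measure.univ_pi_Ioc_ae_eq_Icc (μ := fun _ : Fin 2 => (volume : Measure ℝ))
    (f := fun _ => u) (g := fun _ => v)
  filter_upwards [h.mem_iff] with x hx hx'
  intro i
  have := hx.2 hx' i (Set.mem_univ i)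
  exact ⟨this.1, this.2.trans (by linarith)⟩

variable {T₁ T₂ ε : ℝ}

theorem inner_samp (l : Fin 2 → ℤ) (u : L2) :
    inner ℂ (samp T₁ T₂ ε l) u =
      fourierSample ε l ((Set.Icc (fun _ : Fin 2 => -T₁) (fun _ => T₂)).indicator u) := by
  rw [MeasureTheory.L2.inner_def, fourierSample, ← integral_const_mul]
  refine integral_congr_ae ?_
  filter_upwards [coeFn_toL2 (memLp_sampFun T₁ T₂ ε l)] with x hx
  rw [samp, hx, sampFun]
  by_cases h : x ∈ Set.Icc (fun _ : Fin 2 => -T₁) (fun _ => T₂)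
  · rw [Set.indicator_of_mem h, Set.indicator_of_mem h]
    simp only [RCLike.inner_apply, map_mul, Complex.conj_ofReal, expFun]
    ring
  · rw [Set.indicator_of_notMem h, Set.indicator_of_notMem h]
    simp

theorem inner_samp_of_supportedIn (l : Fin 2 → ℤ) {u : L2} (hu : SupportedIn u (-T₁) T₂) :
    inner ℂ (samp T₁ T₂ ε l) u = fourierSample ε l u := by
  rw [inner_samp]
  refine fourierSample_congr_ae ?_
  filter_upwards [hu] with x hx
  by_cases h : x ∈ Set.Icc (fun _ : Fin 2 => -T₁) (fun _ => T₂)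
  · rw [Set.indicator_of_mem h]
  · rw [Set.indicator_of_notMem h, hx h]

theorem hasSum_inner_samp (hε : 0 < ε) (hε' : T₁ + T₂ ≤ ε⁻¹) (u : L2) :
    HasSum (fun l => ‖inner ℂ (samp T₁ T₂ ε l) u‖ ^ 2)
      (∫ x, ‖(Set.Icc (fun _ : Fin 2 => -T₁) (fun _ => T₂)).indicator u x‖ ^ 2) := by
  simp_rw [inner_samp]
  refine hasSum_fourierSample hε (fun _ => -T₁) ((Lp.memLp u).indicator measurableSet_Icc) ?_
  filter_upwards [ae_mem_cube_of_mem_Icc (-T₁) T₂ ε⁻¹ (by linarith)] with x hx hx'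
  exact Set.indicator_of_notMem (fun h => hx' (hx h)) _

theorem isBessel_samp (hε : 0 < ε) (hε' : T₁ + T₂ ≤ ε⁻¹) (I : Finset (Fin 2 → ℤ)) :
    IsBessel (samp T₁ T₂ ε) I := by
  intro u
  refine ((hasSum_inner_samp hε hε' u).summable.sum_le_tsum I
    (fun _ _ => sq_nonneg _)).trans ?_
  rw [(hasSum_inner_samp hε hε' u).tsum_eq, norm_sq_eq_integral]
  have hint : Integrable fun x => ‖u x‖ ^ 2 :=
    (Lp.memLp u).integrable_norm_pow (by norm_num)
  refine integral_mono_of_nonneg (Eventually.of_forall fun _ => sq_nonneg _) hint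
    (Eventually.of_forall fun x => ?_)
  exact pow_le_pow_left₀ (norm_nonneg _) (norm_indicator_le_norm_self _ _) 2

theorem hasSum_inner_samp_of_supportedIn (hε : 0 < ε) (hε' : T₁ + T₂ ≤ ε⁻¹) {u : L2}
    (hu : SupportedIn u (-T₁) T₂) :
    HasSum (fun l => ‖inner ℂ (samp T₁ T₂ ε l) u‖ ^ 2) (‖u‖ ^ 2) := by
  have h := hasSum_inner_samp hε hε' u
  have h' : ∫ x, ‖(Set.Icc (fun _ : Fin 2 => -T₁) (fun _ => T₂)).indicator u x‖ ^ 2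
      = ‖u‖ ^ 2 := by
    rw [norm_sq_eq_integral]
    refine integral_congr_ae ?_
    filter_upwards [hu] with x hx
    by_cases h : x ∈ Set.Icc (fun _ : Fin 2 => -T₁) (fun _ => T₂)
    · rw [Set.indicator_of_mem h]
    · rw [Set.indicator_of_notMem h, hx h]
  rwa [h'] at h

/-- The samples of a translation difference. -/
theorem sum_norm_expFun_sub_one_le (hε : 0 < ε) (hε' : T₁ + T₂ ≤ ε⁻¹) {u : L2}
    (hu : SupportedIn u (-T₁) T₂) {t : Plane} (ht : ∀ i, |t i| ≤ T₁ + T₂)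
    (I : Finset (Fin 2 → ℤ)) :
    ∑ l ∈ I, ‖expFun ε l t - 1‖ ^ 2 * ‖inner ℂ (samp T₁ T₂ ε l) u‖ ^ 2
      ≤ 9 * ‖trans t u - u‖ ^ 2 := by
  set g := trans t u - u with hg
  have hgae : (g : Plane → ℂ) =ᵐ[volume] (fun x => u (x + t)) - u := by
    filter_upwards [Lp.coeFn_sub (trans t u) u, coeFn_trans t u] with x h1 h2
    rw [h1, Pi.sub_apply, Pi.sub_apply, h2]
  have hsupp : SupportedIn g (-T₁ - (T₁ + T₂)) (T₂ + (T₁ + T₂)) := hu.trans_sub ht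
  -- The difference lives in a square of side `3 (T₁ + T₂)`, too large for Parseval at `ε` but not
  -- at `ε / 3`. The original frequencies are the multiples of `3` there, and `9 = 3 ^ 2`.
  have hε3 : 0 < ε / 3 := by positivity
  have hsum := hasSum_fourierSample hε3 (fun _ => -T₁ - (T₁ + T₂)) (Lp.memLp g) (by
    have hle : T₂ + (T₁ + T₂) - (-T₁ - (T₁ + T₂)) ≤ (ε / 3)⁻¹ := by
      rw [inv_div, div_eq_mul_inv]; linarith
    filter_upwards [hsupp, ae_mem_cube_of_mem_Icc _ _ _ hle] with x h1 h2 h3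
    exact h1 fun h => h3 (h2 h))
  rw [← norm_sq_eq_integral] at hsum
  have hinj : Function.Injective fun l : Fin 2 → ℤ => 3 • l := by
    intro l l' h
    funext i
    have := congrFun h i
    simpa using this
  have hle := sum_le_hasSum (I.map ⟨_, hinj⟩) (fun _ _ => sq_nonneg _) hsum
  rw [Finset.sum_map] at hle
  have key : ∀ l, ‖expFun ε l t - 1‖ ^ 2 * ‖inner ℂ (samp T₁ T₂ ε l) u‖ ^ 2
      = 9 * ‖fourierSample (ε / 3) (3 • l) g‖ ^ 2 := by
    intro l
    rw [inner_samp_of_supportedIn l hu, ← mul_pow, ← norm_mul, sub_mul, one_mul,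
      ← fourierSample_comp_add, ← fourierSample_sub (hu.integrable.comp_add_right t) hu.integrable,
      ← fourierSample_congr_ae hgae, fourierSample_three, norm_mul, mul_pow]
    norm_num
  simp_rw [key]
  rw [← Finset.mul_sum]
  refine mul_le_mul_of_nonneg_left ?_ (by norm_num)
  exact hle

end Sampling

/-! ### Determinant and inverse powers of a scaling matrix -/

section ScalingMatrix

variable {A : Matrix (Fin 2) (Fin 2) ℤ}

/-- The determinant is the product of the two eigenvalues. -/
theorem IsScalingMatrix.one_lt_abs_det (hA : IsScalingMatrix A) : 1 < |A.det| := by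
  set Ac : Matrix (Fin 2) (Fin 2) ℂ := A.map (Int.cast : ℤ → ℂ) with hAc
  have hdet : Ac.det = ((A.det : ℤ) : ℂ) := ((Int.castRingHom ℂ).map_det A).symm
  have hcard : Ac.charpoly.roots.card = 2 := by
    rw [Polynomial.splits_iff_card_roots.1 (IsAlgClosed.splits _),
      Matrix.charpoly_natDegree_eq_dim]
    simp
  obtain ⟨x, y, hxy⟩ := Multiset.card_eq_two.1 hcard
  have hprod := Matrix.det_eq_prod_roots_charpoly Ac
  rw [hxy] at hprod
  simp only [Multiset.insert_eq_cons, Multiset.prod_cons, Multiset.prod_singleton] at hprod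
  have hroot : ∀ z ∈ Ac.charpoly.roots, 1 < ‖z‖ := fun z hz =>
    hA.one_lt_eigenvalue z (Polynomial.isRoot_of_mem_roots hz)
  have hx := hroot x (by rw [hxy]; simp)
  have hy := hroot y (by rw [hxy]; simp)
  have h1 : 1 < ‖((A.det : ℤ) : ℂ)‖ := by
    rw [← hdet, hprod, norm_mul]
    nlinarith
  rw [Complex.norm_intCast] at h1
  exact_mod_cast h1

theorem IsScalingMatrix.det_ne_zero (hA : IsScalingMatrix A) : A.det ≠ 0 := by
  have := hA.one_lt_abs_det
  intro h
  rw [h] at this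
  simp at this

theorem det_powR (A : Matrix (Fin 2) (Fin 2) ℤ) (j : ℕ) : (powR A j).det = (A.det : ℝ) ^ j := by
  have h : (powR A j).det = (((A ^ j).det : ℤ) : ℝ) :=
    ((Int.castRingHom ℝ).map_det (A ^ j)).symm
  rw [h, Matrix.det_pow]
  push_cast
  rfl

theorem det_powR_ne_zero (hA : A.det ≠ 0) (j : ℕ) : (powR A j).det ≠ 0 := by
  rw [det_powR]
  exact_mod_cast pow_ne_zero j hA

theorem powR_eq_pow (A : Matrix (Fin 2) (Fin 2) ℤ) (j : ℕ) : powR A j = powR A 1 ^ j := by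
  have h : ∀ k, powR A k = (Int.castRingHom ℝ).mapMatrix (A ^ k) := fun _ => rfl
  rw [h, h, pow_one, map_pow]

theorem powR_zero (A : Matrix (Fin 2) (Fin 2) ℤ) : powR A 0 = 1 := by
  rw [powR_eq_pow, pow_zero]

theorem powR_one (A : Matrix (Fin 2) (Fin 2) ℤ) : powR A 1 = A.map (Int.cast : ℤ → ℝ) := by
  rw [powR, pow_one]

theorem powR_succ' (A : Matrix (Fin 2) (Fin 2) ℤ) (j : ℕ) :
    powR A (j + 1) = powR A j * powR A 1 := by
  rw [powR_eq_pow A (j + 1), powR_eq_pow A j, pow_succ]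

/-- The inverse powers of a scaling matrix are bounded. -/
theorem IsScalingMatrix.exists_bound_inv (hA : IsScalingMatrix A) :
    ∃ C : ℝ, 0 < C ∧ ∀ j i k, |(powR A j)⁻¹ i k| ≤ C := by
  let M := powR A 1
  have hM : IsUnit M.det := (det_powR_ne_zero hA.det_ne_zero 1).isUnit
  let Bc : Matrix (Fin 2) (Fin 2) ℂ := Complex.ofRealHom.mapMatrix M⁻¹
  let Ac : Matrix (Fin 2) (Fin 2) ℂ := Complex.ofRealHom.mapMatrix M
  have hAc : Ac = A.map (Int.cast : ℤ → ℂ) := by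
    ext i k
    simp [Ac, M, powR]
  have hAB : Ac * Bc = 1 := by
    rw [← map_mul, Matrix.mul_nonsing_inv _ hM, map_one]
  have hBA : Bc * Ac = 1 := by
    rw [← map_mul, Matrix.nonsing_inv_mul _ hM, map_one]
  let U : (Matrix (Fin 2) (Fin 2) ℂ)ˣ := ⟨Ac, Bc, hAB, hBA⟩
  let _ : NormedRing (Matrix (Fin 2) (Fin 2) ℂ) := Matrix.linftyOpNormedRing
  let _ : NormedAlgebra ℂ (Matrix (Fin 2) (Fin 2) ℂ) := Matrix.linftyOpNormedAlgebra
  -- The spectrum of `A⁻¹` consists of inverses of eigenvalues of `A`, so its spectral radius is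
  -- below `1`; Gelfand's formula then bounds all late powers by `1`.
  have hspec : ∀ z ∈ spectrum ℂ Bc, ‖z‖₊ < 1 := by
    intro z hz
    have hz0 : z ≠ 0 := spectrum.ne_zero_of_mem_of_unit (a := U⁻¹) hz
    have h1 : (Units.mk0 z hz0 : ℂ) ∈ spectrum ℂ ((U⁻¹ : (Matrix (Fin 2) (Fin 2) ℂ)ˣ) :
      Matrix (Fin 2) (Fin 2) ℂ) := hz
    rw [spectrum.inv_mem_iff, inv_inv] at h1
    have h2 : z⁻¹ ∈ spectrum ℂ Ac := h1
    rw [hAc, Matrix.mem_spectrum_iff_isRoot_charpoly] at h2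
    have h3 := hA.one_lt_eigenvalue _ h2
    rw [norm_inv] at h3
    have h4 : ‖z‖ < 1 := by
      by_contra h
      exact absurd h3 (not_lt.2 (inv_le_one_of_one_le₀ (not_lt.1 h)))
    exact_mod_cast h4
  have hrad := spectrum.spectralRadius_lt_of_forall_lt Bc hspec
  have hev := (spectrum.pow_nnnorm_pow_one_div_tendsto_nhds_spectralRadius Bc).eventually_lt_const
    hrad
  have hev2 : ∀ᶠ n : ℕ in atTop, ‖Bc ^ n‖ ≤ 1 := by
    filter_upwards [hev, eventually_gt_atTop 0] with n hn hn0
    by_contra h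
    have h1 : (1 : ℝ≥0∞) ≤ (‖Bc ^ n‖₊ : ℝ≥0∞) := by
      exact_mod_cast (not_le.1 h).le
    have h2 := ENNReal.one_le_rpow h1 (z := (1 / n : ℝ)) (by positivity)
    exact absurd hn (not_lt.2 h2)
  obtain ⟨N, hN⟩ := eventually_atTop.1 hev2
  have hentry : ∀ j i k, |(powR A j)⁻¹ i k| ≤ ‖Bc ^ j‖ := by
    intro j i k
    have h1 : Bc ^ j = Complex.ofRealHom.mapMatrix (powR A j)⁻¹ := by
      rw [powR_eq_pow A j, ← Matrix.inv_pow', map_pow]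
    rw [Matrix.linfty_opNorm_def]
    have h2 : ‖(Bc ^ j) i k‖₊ ≤ ∑ k, ‖(Bc ^ j) i k‖₊ :=
      Finset.single_le_sum (f := fun k => ‖(Bc ^ j) i k‖₊) (fun _ _ => zero_le) (Finset.mem_univ k)
    have h3 : ∑ k, ‖(Bc ^ j) i k‖₊ ≤ Finset.univ.sup fun i => ∑ k, ‖(Bc ^ j) i k‖₊ :=
      Finset.le_sup (f := fun i => ∑ k, ‖(Bc ^ j) i k‖₊) (Finset.mem_univ i)
    have h4 : ‖(Bc ^ j) i k‖ = |(powR A j)⁻¹ i k| := by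
      rw [h1]
      simp
    rw [← h4]
    exact_mod_cast h2.trans h3
  refine ⟨1 + ∑ j ∈ Finset.range N, ‖Bc ^ j‖, by positivity, fun j i k => (hentry j i k).trans ?_⟩
  by_cases h : N ≤ j
  · exact (hN j h).trans (le_add_of_nonneg_right (Finset.sum_nonneg fun _ _ => norm_nonneg _))
  · exact (Finset.single_le_sum (f := fun j => ‖Bc ^ j‖) (fun _ _ => norm_nonneg _)
      (Finset.mem_range.2 (not_le.1 h))).trans (le_add_of_nonneg_left zero_le_one)

theorem IsScalingMatrix.pow_nonneg (hA : IsScalingMatrix A) (j : ℕ) :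
    ∀ i k, 0 ≤ (A ^ j) i k := by
  induction j with
  | zero => intro i k; rw [pow_zero, Matrix.one_apply]; split_ifs <;> simp
  | succ j ih =>
    intro i k
    rw [pow_succ, Matrix.mul_apply]
    exact Finset.sum_nonneg fun l _ => mul_nonneg (ih i l) (hA.nonneg l k)

end ScalingMatrix

/-! ### Sums of almost orthogonal vectors -/

section AlmostOrthogonal

variable {H : Type*} [NormedAddCommGroup H] [InnerProductSpace ℂ H]

/-- Vectors of which only boundedly many pairs per index are not orthogonal satisfy a Bessel
synthesis inequality. -/
theorem norm_sum_smul_sq_le {ι : Type*} [AddCommGroup ι] [DecidableEq ι] (N : Finset ι)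
    (D : ι → H) {ω : ℝ} (hD : ∀ m, ‖D m‖ ≤ ω) (h0 : ∀ m n, n - m ∉ N → inner ℂ (D m) (D n) = 0)
    (F : Finset ι) (α : ι → ℂ) :
    ‖∑ m ∈ F, α m • D m‖ ^ 2 ≤ N.card * ω ^ 2 * ∑ m ∈ F, ‖α m‖ ^ 2 := by
  have hω : ∀ _ : ι, 0 ≤ ω := fun m => (norm_nonneg _).trans (hD m)
  -- A Schur test: by AM–GM the Gram sum splits into a row and a column part, and each index meets
  -- at most `N.card` others.
  have hterm : ∀ m n, ‖inner ℂ (α m • D m) (α n • D n)‖ ≤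
      if n - m ∈ N then ω ^ 2 * ((‖α m‖ ^ 2 + ‖α n‖ ^ 2) / 2) else 0 := by
    intro m n
    split_ifs with h
    · have h1 : ‖inner ℂ (D m) (D n)‖ ≤ ω ^ 2 := by
        rw [sq]
        exact (norm_inner_le_norm _ _).trans
          (mul_le_mul (hD m) (hD n) (norm_nonneg _) (hω m))
      rw [inner_smul_left, inner_smul_right, norm_mul, norm_mul, RCLike.norm_conj, ← mul_assoc,
        mul_comm (ω ^ 2)]
      refine mul_le_mul ?_ h1 (norm_nonneg _) (by positivity)
      nlinarith [sq_nonneg (‖α m‖ - ‖α n‖)]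
    · rw [inner_smul_left, inner_smul_right, h0 m n h]
      simp
  have hcount1 : ∀ m, ((F.filter fun n => n - m ∈ N).card : ℝ) ≤ N.card := by
    intro m
    exact_mod_cast Finset.card_le_card_of_injOn (fun n => n - m)
      (fun n hn => (Finset.mem_filter.1 hn).2) (fun x _ y _ h => sub_left_injective h)
  have hcount2 : ∀ n, ((F.filter fun m => n - m ∈ N).card : ℝ) ≤ N.card := by
    intro n
    exact_mod_cast Finset.card_le_card_of_injOn (fun m => n - m)
      (fun m hm => (Finset.mem_filter.1 hm).2) (fun x _ y _ h => sub_right_injective h)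
  have hsum1 : ∑ m ∈ F, ∑ n ∈ F, (if n - m ∈ N then ‖α m‖ ^ 2 else 0)
      ≤ N.card * ∑ m ∈ F, ‖α m‖ ^ 2 := by
    rw [Finset.mul_sum]
    refine Finset.sum_le_sum fun m _ => ?_
    rw [← Finset.sum_filter, Finset.sum_const, nsmul_eq_mul]
    exact mul_le_mul_of_nonneg_right (hcount1 m) (sq_nonneg _)
  have hsum2 : ∑ m ∈ F, ∑ n ∈ F, (if n - m ∈ N then ‖α n‖ ^ 2 else 0)
      ≤ N.card * ∑ m ∈ F, ‖α m‖ ^ 2 := by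
    rw [Finset.sum_comm, Finset.mul_sum]
    refine Finset.sum_le_sum fun m _ => ?_
    rw [← Finset.sum_filter, Finset.sum_const, nsmul_eq_mul]
    exact mul_le_mul_of_nonneg_right (hcount2 m) (sq_nonneg _)
  have h1 : ‖∑ m ∈ F, α m • D m‖ ^ 2 =
      ‖inner ℂ (∑ m ∈ F, α m • D m) (∑ m ∈ F, α m • D m)‖ := by
    rw [inner_self_eq_norm_sq_to_K]; simp
  rw [h1, sum_inner]
  simp_rw [inner_sum]
  calc ‖∑ m ∈ F, ∑ n ∈ F, inner ℂ (α m • D m) (α n • D n)‖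
      ≤ ∑ m ∈ F, ∑ n ∈ F, ‖inner ℂ (α m • D m) (α n • D n)‖ :=
        (norm_sum_le _ _).trans (Finset.sum_le_sum fun m _ => norm_sum_le _ _)
    _ ≤ ∑ m ∈ F, ∑ n ∈ F, if n - m ∈ N then ω ^ 2 * ((‖α m‖ ^ 2 + ‖α n‖ ^ 2) / 2) else 0 :=
        Finset.sum_le_sum fun m _ => Finset.sum_le_sum fun n _ => hterm m n
    _ = ω ^ 2 / 2 * (∑ m ∈ F, ∑ n ∈ F, (if n - m ∈ N then ‖α m‖ ^ 2 else 0)) +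
        ω ^ 2 / 2 * (∑ m ∈ F, ∑ n ∈ F, (if n - m ∈ N then ‖α n‖ ^ 2 else 0)) := by
        simp_rw [Finset.mul_sum, ← Finset.sum_add_distrib]
        refine Finset.sum_congr rfl fun m _ => Finset.sum_congr rfl fun n _ => ?_
        split_ifs <;> ring
    _ ≤ N.card * ω ^ 2 * ∑ m ∈ F, ‖α m‖ ^ 2 := by
        have hc : 0 ≤ ω ^ 2 / 2 := by positivity
        have := mul_le_mul_of_nonneg_left hsum1 hc
        have := mul_le_mul_of_nonneg_left hsum2 hc
        linarith

end AlmostOrthogonal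

/-! ### Translation modulus on `V_0` -/

section Translation

theorem trans_comm (h k : Plane) (f : L2) : trans h (trans k f) = trans k (trans h f) := by
  refine Lp.ext ?_
  filter_upwards [coeFn_trans h (trans k f), coeFn_trans k (trans h f),
    ae_comp_add h (coeFn_trans k f), ae_comp_add k (coeFn_trans h f)] with x h1 h2 h3 h4
  rw [h1, h2, h3, h4, add_right_comm]

theorem exists_norm_trans_sub_le (f : L2) {η : ℝ} (hη : 0 < η) :
    ∃ r : ℝ, 0 < r ∧ ∀ h : Plane, (∀ i, |h i| ≤ r) → ‖trans h f - f‖ ≤ η := by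
  let g : C(Plane, C(Plane, Plane)) :=
    ContinuousMap.curry ⟨fun p : Plane × Plane => p.2 + p.1, by fun_prop⟩
  have hc : Continuous fun h : Plane => trans h f :=
    Continuous.compMeasurePreservingLp (f := fun _ : Plane => f) (g := g) continuous_const
      g.continuous (fun h => measurePreserving_add_right volume h) (by norm_num)
  have h0 : trans 0 f = f := by
    refine Lp.ext ?_
    filter_upwards [coeFn_trans 0 f] with x hx
    rw [hx, add_zero]
  obtain ⟨r, hr, hr'⟩ := Metric.continuousAt_iff.1 (hc.continuousAt (x := 0)) η hη
  refine ⟨r / 2, by positivity, fun h hh => ?_⟩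
  have h1 : dist h 0 < r := by
    rw [dist_zero_right]
    refine lt_of_le_of_lt ((pi_norm_le_iff_of_nonneg (by positivity)).2 fun i => ?_)
      (half_lt_self hr)
    exact hh i
  have h2 := hr' h1
  rw [h0, dist_eq_norm] at h2
  exact h2.le

theorem atom_zero_eq_trans {A : Matrix (Fin 2) (Fin 2) ℤ} (hA : A.det ≠ 0) {φ : Plane → ℂ}
    (hφ : MemLp φ 2 volume) (m : Fin 2 → ℤ) :
    atom A φ 0 m = trans (-intPt m) (toL2 φ) := by
  refine Lp.ext ?_
  filter_upwards [coeFn_toL2 (memLp_atomFun hA hφ 0 m), coeFn_trans (-intPt m) (toL2 φ),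
    ae_comp_add (-intPt m) (coeFn_toL2 hφ)] with x h1 h2 h3
  rw [atom, h1, h2, h3, atomFun, powR_zero, Matrix.one_mulVec]
  simp [sub_eq_add_neg]

theorem SupportedIn.congr {f g : Plane → ℂ} {u v : ℝ} (hf : SupportedIn f u v)
    (h : g =ᵐ[volume] f) : SupportedIn g u v := by
  filter_upwards [hf, h] with x h1 h2 h3
  rw [h2, h1 h3]

/-- The differences of integer points of absolute value at most `K`. -/
def diffBox (K : ℕ) : Finset (Fin 2 → ℤ) := box fun _ => K

/-- Translates further apart than the side of the support square in some coordinate have disjoint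
supports. -/
theorem inner_trans_eq_zero {D : L2} {u v : ℝ} (hD : SupportedIn D u v) {K : ℕ}
    (hK : v - u ≤ K) {m n : Fin 2 → ℤ} (hmn : n - m ∉ diffBox K) :
    inner ℂ (trans (-intPt m) D) (trans (-intPt n) D) = 0 := by
  rw [MeasureTheory.L2.inner_def]
  refine integral_eq_zero_of_ae ?_
  filter_upwards [coeFn_trans (-intPt m) D, coeFn_trans (-intPt n) D,
    ae_comp_add (-intPt m) hD, ae_comp_add (-intPt n) hD] with x h1 h2 h3 h4
  rw [h1, h2]
  by_cases hm : x + -intPt m ∈ Set.Icc (fun _ : Fin 2 => u) (fun _ => v)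
  · by_cases hn : x + -intPt n ∈ Set.Icc (fun _ : Fin 2 => u) (fun _ => v)
    · exfalso
      refine hmn (Fintype.mem_piFinset.2 fun i => Finset.mem_Icc.2 ?_)
      have a1 := hm.1 i
      have a2 := hm.2 i
      have a3 := hn.1 i
      have a4 := hn.2 i
      simp only [Pi.add_apply, Pi.neg_apply, intPt] at a1 a2 a3 a4
      have b1 : ((n i - m i : ℤ) : ℝ) ≤ K := by push_cast; linarith
      have b2 : (-(K : ℝ)) ≤ ((n i - m i : ℤ) : ℝ) := by push_cast; linarith
      exact ⟨by exact_mod_cast b2, by exact_mod_cast b1⟩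
    · rw [h4 hn]; simp
  · rw [h3 hm]; simp

/-- The translation modulus in the closed span of the integer translates of a compactly supported
orthonormal generator. -/
theorem norm_trans_sub_sq_le_of_mem_closure {Φ : L2} {u v : ℝ} (hΦ : SupportedIn Φ u v)
    (ho : Orthonormal ℂ fun m : Fin 2 → ℤ => trans (-intPt m) Φ) {K : ℕ} (hK : v - u + 2 ≤ K)
    {h : Plane} (hh : ∀ i, |h i| ≤ 1) {f : L2}
    (hf : f ∈ (Submodule.span ℂ
      (Set.range fun m : Fin 2 → ℤ => trans (-intPt m) Φ)).topologicalClosure) :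
    ‖trans h f - f‖ ^ 2 ≤ (diffBox K).card * ‖trans h Φ - Φ‖ ^ 2 * ‖f‖ ^ 2 := by
  have hclosed : IsClosed {f : L2 | ‖trans h f - f‖ ^ 2 ≤
      (diffBox K).card * ‖trans h Φ - Φ‖ ^ 2 * ‖f‖ ^ 2} :=
    isClosed_le ((((trans h).continuous.sub continuous_id).norm).pow 2) (by fun_prop)
  refine (closure_minimal ?_ hclosed) hf
  intro g hg
  obtain ⟨c, rfl⟩ := Finsupp.mem_span_range_iff_exists_finsupp.1 hg
  simp only [Set.mem_ofPred_eq, Finsupp.sum]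
  set D := trans h Φ - Φ with hD
  -- Translations commute, so the difference is the same combination of translates of `D`. The
  -- support of `D` is wider by `1` on each side, hence the `2` in `hK`.
  have h1 : trans h (∑ m ∈ c.support, c m • trans (-intPt m) Φ)
      - ∑ m ∈ c.support, c m • trans (-intPt m) Φ
      = ∑ m ∈ c.support, c m • trans (-intPt m) D := by
    rw [map_sum, ← Finset.sum_sub_distrib]
    refine Finset.sum_congr rfl fun m _ => ?_
    rw [map_smul, ← smul_sub, trans_comm, ← map_sub]
  have h2 : ‖∑ m ∈ c.support, c m • trans (-intPt m) Φ‖ ^ 2 = ∑ m ∈ c.support, ‖c m‖ ^ 2 := by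
    have h3 := ho.inner_sum c c c.support
    rw [inner_self_eq_norm_sq_to_K] at h3
    have h4 : (∑ i ∈ c.support, (starRingEnd ℂ) (c i) * c i)
        = ((∑ m ∈ c.support, ‖c m‖ ^ 2 : ℝ) : ℂ) := by
      push_cast
      refine Finset.sum_congr rfl fun m _ => ?_
      rw [mul_comm, Complex.mul_conj, Complex.normSq_eq_norm_sq]
      push_cast; rfl
    rw [h4] at h3
    refine Complex.ofReal_injective ?_
    rw [← h3, Complex.ofReal_pow]
    rfl
  rw [h1, h2]
  refine norm_sum_smul_sq_le (diffBox K) (fun m => trans (-intPt m) D)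
    (fun m => ((trans (-intPt m)).norm_map D).le) (fun m n hmn => ?_) _ _
  exact inner_trans_eq_zero (hΦ.trans_sub hh) (by linarith) hmn

end Translation

/-! ### Transport of the translation modulus from `V_0` to `V_J` -/

section Dilation

variable {A : Matrix (Fin 2) (Fin 2) ℤ}

theorem quasiMeasurePreserving_mulVec {B : Matrix (Fin 2) (Fin 2) ℝ} (hB : B.det ≠ 0) :
    Measure.QuasiMeasurePreserving (fun x : Plane => B *ᵥ x) volume volume := by
  have h := Real.map_matrix_volume_pi_eq_smul_volume_pi hB
  refine ⟨(Matrix.toLin' B).continuous_of_finiteDimensional.measurable, ?_⟩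
  change Measure.map (Matrix.toLin' B) volume ≪ volume
  rw [h]
  exact Measure.smul_absolutelyContinuous

theorem memLp_comp_mulVec {B : Matrix (Fin 2) (Fin 2) ℝ} (hB : B.det ≠ 0) {f : Plane → ℂ}
    (hf : MemLp f 2 volume) : MemLp (fun x => f (B *ᵥ x)) 2 volume := by
  have h2 : MemLp f 2 (Measure.map (Matrix.toLin' B) (volume : Measure Plane)) := by
    rw [Real.map_matrix_volume_pi_eq_smul_volume_pi hB]
    exact hf.smul_measure ENNReal.ofReal_ne_top
  exact h2.comp_of_map (Matrix.toLin' B).continuous_of_finiteDimensional.aemeasurable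

theorem norm_sq_of_ae_eq_comp_mulVec {B : Matrix (Fin 2) (Fin 2) ℝ} (hB : B.det ≠ 0) {f g : L2}
    (h : (g : Plane → ℂ) =ᵐ[volume] fun x => f (B *ᵥ x)) :
    ‖g‖ ^ 2 = |B.det⁻¹| * ‖f‖ ^ 2 := by
  rw [norm_sq_eq_integral, norm_sq_eq_integral]
  have h1 : ∫ x, ‖g x‖ ^ 2 = ∫ x, ‖f (Matrix.toLin' B x)‖ ^ 2 := by
    refine integral_congr_ae ?_
    filter_upwards [h] with x hx
    rw [hx]; rfl
  have h2 := integral_map (μ := (volume : Measure Plane)) (φ := Matrix.toLin' B)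
    (Matrix.toLin' B).continuous_of_finiteDimensional.aemeasurable (f := fun x => ‖f x‖ ^ 2) (by
      rw [Real.map_matrix_volume_pi_eq_smul_volume_pi hB]
      exact ((Lp.aestronglyMeasurable f).norm.pow 2).smul_measure _)
  rw [h1, ← h2, Real.map_matrix_volume_pi_eq_smul_volume_pi hB, integral_smul_measure,
    ENNReal.toReal_ofReal (abs_nonneg _), smul_eq_mul]

/-- A bound for the translation modulus in `V_0` scales to all `V_J`. -/
theorem IsMRA.norm_trans_sub_sq_le {V : ℤ → Submodule ℂ L2} {φ : Plane → ℂ} (hV : IsMRA A V φ)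
    (hA : A.det ≠ 0) {h : Plane} {c : ℝ}
    (h0 : ∀ f ∈ V 0, ‖trans h f - f‖ ^ 2 ≤ c * ‖f‖ ^ 2) (J : ℕ) :
    ∀ f ∈ V J, ‖trans ((powR A J)⁻¹ *ᵥ h) f - f‖ ^ 2 ≤ c * ‖f‖ ^ 2 := by
  have hA1 : (powR A 1).det ≠ 0 := det_powR_ne_zero hA 1
  induction J with
  | zero =>
    intro f hf
    rw [powR_zero, inv_one, Matrix.one_mulVec]
    exact h0 f (by exact_mod_cast hf)
  | succ J ih =>
    intro f hf
    have hinv : (powR A 1)⁻¹.det ≠ 0 := by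
      rw [Matrix.det_nonsing_inv, Ring.inverse_eq_inv']; exact inv_ne_zero hA1
    have hgm := memLp_comp_mulVec hinv (Lp.memLp f)
    -- Undilating once puts `g` in `V J` and turns the shift `t` into `A t`. Both sides of the
    -- inequality scale by the same Jacobian.
    set g : L2 := toL2 (fun x => f ((powR A 1)⁻¹ *ᵥ x)) with hg
    have hfg : (f : Plane → ℂ) =ᵐ[volume] fun x => g (powR A 1 *ᵥ x) := by
      filter_upwards [(quasiMeasurePreserving_mulVec hA1).ae (coeFn_toL2 hgm)] with x hx
      rw [hx, Matrix.mulVec_mulVec, Matrix.nonsing_inv_mul _ hA1.isUnit, Matrix.one_mulVec]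
    have hgV : g ∈ V J := (hV.dilation J g f hfg).2 (by exact_mod_cast hf)
    set t := (powR A (J + 1))⁻¹ *ᵥ h with ht
    have htt : powR A 1 *ᵥ t = (powR A J)⁻¹ *ᵥ h := by
      rw [ht, powR_succ' A J, Matrix.mul_inv_rev, Matrix.mulVec_mulVec, ← Matrix.mul_assoc,
        Matrix.mul_nonsing_inv _ hA1.isUnit, Matrix.one_mul]
    have hdiff : ((trans t f - f : L2) : Plane → ℂ) =ᵐ[volume]
        fun x => (trans ((powR A J)⁻¹ *ᵥ h) g - g : L2) (powR A 1 *ᵥ x) := by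
      filter_upwards [Lp.coeFn_sub (trans t f) f, coeFn_trans t f, hfg, ae_comp_add t hfg,
        (quasiMeasurePreserving_mulVec hA1).ae
          (Lp.coeFn_sub (trans ((powR A J)⁻¹ *ᵥ h) g) g),
        (quasiMeasurePreserving_mulVec hA1).ae (coeFn_trans ((powR A J)⁻¹ *ᵥ h) g)]
        with x h1 h2 h3 h4 h5 h6
      rw [h1, Pi.sub_apply, h2, h4, h3, h5, Pi.sub_apply, h6, Matrix.mulVec_add, htt]
    rw [norm_sq_of_ae_eq_comp_mulVec hA1 hdiff, norm_sq_of_ae_eq_comp_mulVec hA1 hfg,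
      mul_left_comm]
    exact mul_le_mul_of_nonneg_left (ih g hgV) (abs_nonneg _)

end Dilation

/-! ### Energy of the samples outside of the box -/

section Tail

theorem norm_exp_mul_I_sub_one_sq (t : ℝ) :
    ‖Complex.exp ((t : ℂ) * Complex.I) - 1‖ ^ 2 = 2 - 2 * Real.cos t := by
  rw [← Complex.normSq_eq_norm_sq, Complex.normSq_apply]
  simp only [Complex.sub_re, Complex.sub_im, Complex.one_re, Complex.one_im, sub_zero,
    Complex.exp_ofReal_mul_I_re, Complex.exp_ofReal_mul_I_im]
  nlinarith [Real.sin_sq_add_cos_sq t]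

/-- For high frequencies the mean of `|exp(2 π i s y) - 1|²` over `[0, r]` is at least `1`. -/
theorem le_integral_two_sub_two_cos {y S r : ℝ} (hS : 0 < S) (hy : S ≤ |y|)
    (hr : 1 ≤ Real.pi * S * r) :
    r ≤ ∫ s in (0 : ℝ)..r, (2 - 2 * Real.cos (2 * Real.pi * y * s)) := by
  have hy0 : y ≠ 0 := by
    intro h; rw [h, abs_zero] at hy; linarith
  have hc : 2 * Real.pi * y ≠ 0 := by
    have := Real.pi_ne_zero
    positivity
  have h1 : ∫ s in (0 : ℝ)..r, (2 - 2 * Real.cos (2 * Real.pi * y * s))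
      = 2 * r - 2 * ((2 * Real.pi * y)⁻¹ * Real.sin (2 * Real.pi * y * r)) := by
    rw [intervalIntegral.integral_sub (by simp)
      (Continuous.intervalIntegrable (by fun_prop) _ _), intervalIntegral.integral_const,
      intervalIntegral.integral_const_mul,
      intervalIntegral.integral_comp_mul_left (fun x => Real.cos x) hc, integral_cos]
    simp
    ring
  rw [h1]
  have h2 : |(2 * Real.pi * y)⁻¹ * Real.sin (2 * Real.pi * y * r)| ≤ (2 * Real.pi * S)⁻¹ := by
    rw [abs_mul, abs_inv, abs_mul, abs_of_pos Real.two_pi_pos]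
    calc (2 * Real.pi * |y|)⁻¹ * |Real.sin (2 * Real.pi * y * r)|
        ≤ (2 * Real.pi * |y|)⁻¹ * 1 :=
          mul_le_mul_of_nonneg_left (Real.abs_sin_le_one _)
            (inv_nonneg.2 (mul_nonneg Real.two_pi_pos.le (abs_nonneg y)))
      _ ≤ (2 * Real.pi * S)⁻¹ := by
          rw [mul_one]
          exact inv_anti₀ (mul_pos Real.two_pi_pos hS)
            (mul_le_mul_of_nonneg_left hy Real.two_pi_pos.le)
  -- The integral is `2 r` minus an oscillating term, which `hr` keeps below `r`.
  have h3 : 2 * (2 * Real.pi * S)⁻¹ ≤ r := by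
    rw [← div_eq_mul_inv, div_le_iff₀ (mul_pos Real.two_pi_pos hS)]
    nlinarith
  have := (abs_le.1 h2).2
  linarith

/-- The point of the plane with the `i`-th coordinate `s` and the other one `0`. -/
def axisPt (i : Fin 2) (s : ℝ) : Plane := Pi.single i s

variable {T₁ T₂ ε : ℝ}

theorem norm_expFun_sub_one_sq (ε : ℝ) (l : Fin 2 → ℤ) (B : Matrix (Fin 2) (Fin 2) ℝ)
    (i : Fin 2) (s : ℝ) :
    ‖expFun ε l (B *ᵥ axisPt i s) - 1‖ ^ 2
      = 2 - 2 * Real.cos (2 * Real.pi * ((ε • intPt l) ᵥ* B) i * s) := by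
  have h : intPt l ⬝ᵥ (B *ᵥ axisPt i s) = (intPt l ᵥ* B) i * s := by
    rw [Matrix.dotProduct_mulVec, axisPt, dotProduct_single]
  rw [expFun_eq, norm_exp_mul_I_sub_one_sq, h, Matrix.smul_vecMul, Pi.smul_apply, smul_eq_mul]
  ring_nf

/-- The energy of the samples at frequencies that are high in the coordinates given by `B` is
bounded by the translation modulus along the images of the axes. -/
theorem sum_high_frequency_le (hε : 0 < ε) (hε' : T₁ + T₂ ≤ ε⁻¹) {u : L2}
    (hu : SupportedIn u (-T₁) T₂) {B : Matrix (Fin 2) (Fin 2) ℝ} {S r κ : ℝ} (hS : 0 < S)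
    (hr0 : 0 < r) (hr : 1 ≤ Real.pi * S * r)
    (hB : ∀ i, ∀ s ∈ Set.Icc 0 r, ∀ k, |(B *ᵥ axisPt i s) k| ≤ T₁ + T₂)
    (hκ : ∀ i, ∀ s ∈ Set.Icc 0 r, ‖trans (B *ᵥ axisPt i s) u - u‖ ^ 2 ≤ κ)
    (F : Finset (Fin 2 → ℤ)) (hF : ∀ l ∈ F, ∃ i, S ≤ |((ε • intPt l) ᵥ* B) i|) :
    ∑ l ∈ F, ‖inner ℂ (samp T₁ T₂ ε l) u‖ ^ 2 ≤ 18 * κ := by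
  set c : (Fin 2 → ℤ) → ℝ := fun l => ‖inner ℂ (samp T₁ T₂ ε l) u‖ ^ 2 with hc
  set w : (Fin 2 → ℤ) → Fin 2 → ℝ → ℝ := fun l i s =>
    2 - 2 * Real.cos (2 * Real.pi * ((ε • intPt l) ᵥ* B) i * s) with hw
  have hw0 : ∀ l i s, 0 ≤ w l i s := fun l i s => by
    have := Real.cos_le_one (2 * Real.pi * ((ε • intPt l) ᵥ* B) i * s)
    simp only [hw]; linarith
  have hwc : ∀ l i, Continuous (w l i) := fun l i => by simp only [hw]; fun_prop
  have hint0 : ∀ l i, 0 ≤ ∫ s in (0 : ℝ)..r, w l i s := fun l i =>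
    intervalIntegral.integral_nonneg hr0.le fun s _ => hw0 l i s
  -- A high frequency has a large coordinate along one axis, where the averaged weight is already at
  -- least `r`; the other axis contributes a non-negative amount.
  have h1 : ∀ l ∈ F, r * c l ≤ ∑ i, ∫ s in (0 : ℝ)..r, w l i s * c l := by
    intro l hl
    obtain ⟨i, hi⟩ := hF l hl
    simp_rw [intervalIntegral.integral_mul_const]
    rw [← Finset.sum_mul]
    refine mul_le_mul_of_nonneg_right ?_ (sq_nonneg _)
    exact (le_integral_two_sub_two_cos hS hi hr).trans
      (Finset.single_le_sum (f := fun i => ∫ s in (0 : ℝ)..r, w l i s) (fun i _ => hint0 l i)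
        (Finset.mem_univ i))
  have h2 : ∀ i, ∑ l ∈ F, ∫ s in (0 : ℝ)..r, w l i s * c l ≤ r * (9 * κ) := by
    intro i
    have hswap := intervalIntegral.integral_finsetSum (a := 0) (b := r) (μ := volume) (s := F)
      (f := fun l s => w l i s * c l) fun l _ =>
        Continuous.intervalIntegrable (by have := hwc l i; fun_prop) _ _
    rw [← hswap]
    calc ∫ s in (0 : ℝ)..r, ∑ l ∈ F, w l i s * c l
        ≤ ∫ s in (0 : ℝ)..r, 9 * κ := by
          refine intervalIntegral.integral_mono_on hr0.le
            (Continuous.intervalIntegrable (by fun_prop) _ _) (by simp) fun s hs => ?_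
          have h3 := sum_norm_expFun_sub_one_le hε hε' hu (hB i s hs) F
          simp_rw [norm_expFun_sub_one_sq] at h3
          have := hκ i s hs
          exact h3.trans (by linarith)
      _ = r * (9 * κ) := by simp; ring
  -- Two axes, each with the constant `9` of the translation estimate.
  have h4 : r * ∑ l ∈ F, c l ≤ r * (18 * κ) := by
    rw [Finset.mul_sum]
    calc ∑ l ∈ F, r * c l ≤ ∑ l ∈ F, ∑ i, ∫ s in (0 : ℝ)..r, w l i s * c l :=
          Finset.sum_le_sum h1
      _ = ∑ i, ∑ l ∈ F, ∫ s in (0 : ℝ)..r, w l i s * c l := Finset.sum_comm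
      _ ≤ ∑ _i : Fin 2, r * (9 * κ) := Finset.sum_le_sum fun i _ => h2 i
      _ = r * (18 * κ) := by simp; ring
  exact le_of_mul_le_mul_left h4 hr0

/-- Frequencies outside of the sampling box are high in the coordinates of the dilation. -/
theorem exists_le_abs_of_notMem_box {A : Matrix (Fin 2) (Fin 2) ℤ} (hA : IsScalingMatrix A)
    {J : ℕ} {S : ℝ} (hε : 0 < ε) {M : Fin 2 → ℕ}
    (hM : ∀ i, (((A ^ J) 0 i + (A ^ J) 1 i : ℤ) : ℝ) / ε * S ≤ M i) {l : Fin 2 → ℤ}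
    (hl : l ∉ box M) : ∃ i, S ≤ |((ε • intPt l) ᵥ* (powR A J)⁻¹) i| := by
  -- If both coordinates of `y = ε l A^{-J}` were below `S`, then `ε l = y A^J` would be bounded by
  -- `S` times the column sums, putting `l` in the box.
  by_contra! hcon
  have hdet := det_powR_ne_zero hA.det_ne_zero J
  set y := (ε • intPt l) ᵥ* (powR A J)⁻¹ with hy
  have hyA : y ᵥ* powR A J = ε • intPt l := by
    rw [hy, Matrix.vecMul_vecMul, Matrix.nonsing_inv_mul _ hdet.isUnit, Matrix.vecMul_one]
  refine hl (Fintype.mem_piFinset.2 fun i => Finset.mem_Icc.2 (abs_le.1 ?_))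
  have h1 := congrFun hyA i
  simp only [Matrix.vecMul, dotProduct, Fin.sum_univ_two, Pi.smul_apply, smul_eq_mul, intPt] at h1
  have h2 : ∀ k, 0 ≤ powR A J k i := fun k => by
    rw [powR, Matrix.map_apply]; exact_mod_cast hA.pow_nonneg J k i
  have h3 : |ε * (l i : ℝ)| ≤ S * (powR A J 0 i + powR A J 1 i) := by
    rw [← h1]
    refine (abs_add_le _ _).trans ?_
    rw [abs_mul, abs_mul, abs_of_nonneg (h2 0), abs_of_nonneg (h2 1), mul_add]
    exact add_le_add (mul_le_mul_of_nonneg_right (hcon 0).le (h2 0))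
      (mul_le_mul_of_nonneg_right (hcon 1).le (h2 1))
  have h4 : S * (powR A J 0 i + powR A J 1 i) ≤ ε * M i := by
    have := hM i
    rw [div_mul_eq_mul_div, div_le_iff₀ hε] at this
    simp only [powR, Matrix.map_apply]
    push_cast at this
    linarith
  rw [abs_mul, abs_of_pos hε] at h3
  have h5 := le_of_mul_le_mul_left (h3.trans h4) hε
  exact_mod_cast h5

end Tail

/-! ### The energy estimate for the reconstruction spaces -/

section Captures

variable {A : Matrix (Fin 2) (Fin 2) ℤ} {V : ℤ → Submodule ℂ L2} {φ : Plane → ℂ}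
  {ψ : WIdx A → Plane → ℂ} {a : ℕ} {T₁ T₂ : ℝ}

theorem IsMRA.mono (hV : IsMRA A V φ) : Monotone V :=
  monotone_int_of_le_succ hV.le_succ

theorem reconSpace_le (hV : IsMRA A V φ) (hψ : IsWaveletSystem A V ψ) (a J : ℕ) :
    reconSpace A φ ψ a J ≤ V J := by
  refine sup_le ?_ (iSup_le fun j => ?_)
  · refine Submodule.span_le.2 ?_
    rintro _ ⟨m, rfl⟩
    refine hV.mono (show (0 : ℤ) ≤ J by positivity) ?_
    rw [← hV.span_eq]
    exact Submodule.le_topologicalClosure _ (Submodule.subset_span ⟨m.1, rfl⟩)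
  · refine Submodule.span_le.2 ?_
    rintro _ ⟨q, rfl⟩
    refine hV.mono (show ((j : ℕ) : ℤ) + 1 ≤ J by have := j.2; omega) ?_
    have h : atom A (ψ q.1) j q.2 ∈ V ((j : ℕ) + 1) ⊓ (V ((j : ℕ) : ℤ))ᗮ := by
      rw [← hψ.span_eq]
      exact Submodule.le_topologicalClosure _ (Submodule.subset_span ⟨(q.1, q.2.1), rfl⟩)
    exact h.1

theorem reconSpace_le_full (A : Matrix (Fin 2) (Fin 2) ℤ) (φ : Plane → ℂ)
    (ψ : WIdx A → Plane → ℂ) (a J : ℕ) : reconSpace A φ ψ a J ≤ reconSpaceFull A φ ψ a := by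
  refine le_trans ?_ (Submodule.le_topologicalClosure _)
  exact sup_le_sup le_rfl (iSup_le fun j => le_iSup (fun j : ℕ => truncW A ψ a j) j)

theorem exists_unit_mem_reconSpace (hV : IsMRA A V φ) (ha : 1 ≤ a) (J : ℕ) :
    ∃ u ∈ reconSpace A φ ψ a J, ‖u‖ = 1 := by
  refine ⟨atom A φ 0 0, ?_, hV.orthonormal.1 0⟩
  refine Submodule.mem_sup_left (Submodule.subset_span ⟨⟨0, ?_⟩, rfl⟩)
  refine Fintype.mem_piFinset.2 fun i => Finset.mem_Ioo.2 ?_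
  fin_cases i <;> simp <;> omega

/-- For sampling boxes adapted to the dilation, the samples capture almost all of the energy of the
reconstruction spaces. -/
theorem exists_captures (hA : IsScalingMatrix A) (hV : IsMRA A V φ)
    (hψ : IsWaveletSystem A V ψ) (hφ : SupportedIn φ 0 a) (hT₁ : 0 < T₁) (hT₂ : 0 < T₂)
    (hT : ∀ f ∈ reconSpaceFull A φ ψ a, SupportedIn f (-T₁) T₂) {δ : ℝ} (hδ : 0 < δ) :
    ∃ S : ℝ, 0 < S ∧ ∀ (J : ℕ) (ε : ℝ), 0 < ε → ε ≤ 1 / (T₁ + T₂) → ∀ M : Fin 2 → ℕ,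
      (∀ i, (((A ^ J) 0 i + (A ^ J) 1 i : ℤ) : ℝ) / ε * S ≤ M i) →
      Captures (reconSpace A φ ψ a J) (samp T₁ T₂ ε) (box M) δ := by
  have hdet := hA.det_ne_zero
  set Φ := toL2 φ with hΦ
  have hΦs : SupportedIn Φ 0 a := hφ.congr (coeFn_toL2 hV.memLp)
  have hatom : (fun m : Fin 2 → ℤ => atom A φ 0 m) = fun m => trans (-intPt m) Φ :=
    funext fun m => atom_zero_eq_trans hdet hV.memLp m
  have ho : Orthonormal ℂ fun m : Fin 2 → ℤ => trans (-intPt m) Φ := hatom ▸ hV.orthonormal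
  set N : ℝ := ((diffBox (a + 2)).card : ℝ) with hN
  -- `N * η ^ 2` will bound the squared translation modulus and `18` is the constant of
  -- `sum_high_frequency_le`.
  obtain ⟨η, hη, hηδ⟩ : ∃ η : ℝ, 0 < η ∧ 18 * (N * η ^ 2) ≤ δ := by
    have hN0 : 0 ≤ N := Nat.cast_nonneg _
    have hp : 0 < δ / (18 * (N + 1)) := by positivity
    refine ⟨√(δ / (18 * (N + 1))), Real.sqrt_pos.2 hp, ?_⟩
    rw [Real.sq_sqrt hp.le, ← mul_assoc, mul_div_assoc', div_le_iff₀ (by positivity)]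
    nlinarith
  obtain ⟨r₁, hr₁, hmod⟩ := exists_norm_trans_sub_le Φ hη
  obtain ⟨C, hC, hinv⟩ := hA.exists_bound_inv
  -- The bound `1` limits the growth of supports, `r₁` makes the modulus of `Φ` at most `η`, and the
  -- last bound keeps the shifts `A^{-J} h` within `T₁ + T₂` for all `J` at once.
  set r := min (min 1 r₁) ((T₁ + T₂) / C) with hr
  have hr0 : 0 < r := by positivity
  -- The least `S` with `1 ≤ π S r`; it depends on neither `J` nor `ε`.
  refine ⟨1 / (Real.pi * r), by positivity, ?_⟩
  intro J ε hε hε1 M hM f hf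
  have hε' : T₁ + T₂ ≤ ε⁻¹ := by
    rw [le_inv_comm₀ (by positivity) hε, ← one_div]; exact hε1
  have hfs : SupportedIn f (-T₁) T₂ := hT f (reconSpace_le_full A φ ψ a J hf)
  have haxis : ∀ i, ∀ s ∈ Set.Icc 0 r, ∀ k, |axisPt i s k| ≤ r := by
    intro i s hs k
    rw [axisPt, Pi.single_apply]
    split_ifs
    · rw [abs_of_nonneg hs.1]; exact hs.2
    · rw [abs_zero]; exact hr0.le
  have hV0 : ∀ i, ∀ s ∈ Set.Icc 0 r, ∀ g ∈ V 0,
      ‖trans (axisPt i s) g - g‖ ^ 2 ≤ N * η ^ 2 * ‖g‖ ^ 2 := by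
    intro i s hs g hg
    rw [← hV.span_eq, hatom] at hg
    refine (norm_trans_sub_sq_le_of_mem_closure hΦs ho (K := a + 2) (by push_cast; linarith)
      (fun k => (haxis i s hs k).trans ((min_le_left _ _).trans (min_le_left _ _))) hg).trans ?_
    refine mul_le_mul_of_nonneg_right (mul_le_mul_of_nonneg_left ?_ (Nat.cast_nonneg _))
      (sq_nonneg _)
    exact pow_le_pow_left₀ (norm_nonneg _) (hmod _ fun k =>
      (haxis i s hs k).trans ((min_le_left _ _).trans (min_le_right _ _))) 2
  have hκ : ∀ i, ∀ s ∈ Set.Icc 0 r, ‖trans ((powR A J)⁻¹ *ᵥ axisPt i s) f - f‖ ^ 2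
      ≤ N * η ^ 2 * ‖f‖ ^ 2 := fun i s hs =>
    hV.norm_trans_sub_sq_le hdet (hV0 i s hs) J f (reconSpace_le hV hψ a J hf)
  have hB : ∀ i, ∀ s ∈ Set.Icc 0 r, ∀ k, |((powR A J)⁻¹ *ᵥ axisPt i s) k| ≤ T₁ + T₂ := by
    intro i s hs k
    rw [axisPt, Matrix.mulVec_single, Pi.smul_apply, Matrix.col_apply]
    simp only [MulOpposite.smul_eq_mul_unop, MulOpposite.unop_op]
    rw [abs_mul, abs_of_nonneg hs.1]
    calc |(powR A J)⁻¹ k i| * s ≤ C * ((T₁ + T₂) / C) :=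
          mul_le_mul (hinv J k i) (hs.2.trans (min_le_right _ _)) hs.1 hC.le
      _ = T₁ + T₂ := by field_simp
  have hsum := hasSum_inner_samp_of_supportedIn hε hε' hfs
  have hle : ‖f‖ ^ 2 ≤ ∑ l ∈ box M, ‖inner ℂ (samp T₁ T₂ ε l) f‖ ^ 2 + δ * ‖f‖ ^ 2 := by
    refine hasSum_le_of_sum_le hsum fun F => ?_
    have h1 := sum_high_frequency_le hε hε' hfs (S := 1 / (Real.pi * r)) (by positivity) hr0
      (by have := Real.pi_pos; field_simp; exact le_rfl) hB hκ (F \ box M) (fun l hl =>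
        exists_le_abs_of_notMem_box hA hε hM (Finset.mem_sdiff.1 hl).2)
    have h2 : ∑ l ∈ F, ‖inner ℂ (samp T₁ T₂ ε l) f‖ ^ 2 ≤
        ∑ l ∈ F \ box M, ‖inner ℂ (samp T₁ T₂ ε l) f‖ ^ 2 +
        ∑ l ∈ box M, ‖inner ℂ (samp T₁ T₂ ε l) f‖ ^ 2 := by
      rw [← Finset.sum_union Finset.sdiff_disjoint, Finset.sdiff_union_self_eq_union]
      exact Finset.sum_le_sum_of_subset_of_nonneg Finset.subset_union_left
        fun _ _ _ => sq_nonneg _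
    have h3 : 18 * (N * η ^ 2 * ‖f‖ ^ 2) ≤ δ * ‖f‖ ^ 2 := by
      rw [← mul_assoc]
      exact mul_le_mul_of_nonneg_right hηδ (sq_nonneg _)
    linarith
  linarith

end Captures

/-! ### Lower bound for the mesh norm by volume -/

section Mesh

variable {A : Matrix (Fin 2) (Fin 2) ℤ}

theorem contract_eq (A : Matrix (Fin 2) (Fin 2) ℤ) (ε : ℝ) (J : ℕ) (x : Plane) :
    contract A ε J x = Matrix.toLin' (ε • (powR A J)⁻¹) x := by
  rw [contract, Matrix.toLin'_apply, Matrix.smul_mulVec]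

theorem contract_sub (A : Matrix (Fin 2) (Fin 2) ℤ) (ε : ℝ) (J : ℕ) (x y : Plane) :
    contract A ε J (x - y) = contract A ε J x - contract A ε J y := by
  simp_rw [contract_eq, map_sub]

theorem meshNorm_nonneg (A : Matrix (Fin 2) (Fin 2) ℤ) (ε : ℝ) (J : ℕ) (M : Fin 2 → ℕ) :
    0 ≤ meshNorm A ε J M := by
  refine Real.sSup_nonneg ?_
  rintro _ ⟨x, _, rfl⟩
  refine Real.sInf_nonneg ?_
  rintro _ ⟨l, _, k, rfl⟩
  exact norm_nonneg _

theorem zero_mem_box (M : Fin 2 → ℕ) : (0 : Fin 2 → ℤ) ∈ box M :=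
  Fintype.mem_piFinset.2 fun i => Finset.mem_Icc.2 (by simp)

theorem intPt_zero : intPt 0 = 0 := by
  funext i; simp [intPt]

theorem contract_zero (A : Matrix (Fin 2) (Fin 2) ℤ) (ε : ℝ) (J : ℕ) :
    contract A ε J 0 = 0 := by
  rw [contract_eq, map_zero]

/-- Every point of the rectangle is close to the integer lattice after contraction. -/
theorem exists_norm_contract_sub_lt {ε : ℝ} {J : ℕ} {M : Fin 2 → ℕ} {δ : ℝ}
    (hδ : meshNorm A ε J M < δ) {y : Plane} (hy : y ∈ rect M) :
    ∃ n : Fin 2 → ℤ, ‖contract A ε J (y - intPt n)‖ < δ := by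
  set S : Plane → Set ℝ := fun x => {d : ℝ | ∃ l ∈ box M, ∃ k : Fin 2 → ℤ,
      d = ‖x - contract A ε J (intPt l) + contract A ε J (intPt k)‖} with hS
  have hmem : ∀ x, ‖x‖ ∈ S x := fun x =>
    ⟨0, zero_mem_box M, 0, by simp [intPt_zero, contract_zero]⟩
  have hbdd : ∀ x, BddBelow (S x) := fun x =>
    ⟨0, by rintro _ ⟨l, _, k, rfl⟩; exact norm_nonneg _⟩
  have hcont : Continuous (contract A ε J) := by
    have : contract A ε J = Matrix.toLin' (ε • (powR A J)⁻¹) := funext (contract_eq A ε J)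
    rw [this]
    exact LinearMap.continuous_of_finiteDimensional _
  obtain ⟨R, hR⟩ := (isCompact_Icc.image hcont).isBounded.exists_norm_le
    (s := contract A ε J '' rect M)
  -- Boundedness is essential: the real supremum of an unbounded set is `0` by convention.
  have hsup : BddAbove ((fun x => sInf (S x)) '' (contract A ε J '' rect M)) := by
    refine ⟨R, ?_⟩
    rintro _ ⟨x, hx, rfl⟩
    exact (csInf_le (hbdd x) (hmem x)).trans (hR x hx)
  have h1 : sInf (S (contract A ε J y)) < δ :=
    (le_csSup hsup ⟨_, ⟨y, hy, rfl⟩, rfl⟩).trans_lt hδ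
  obtain ⟨_, ⟨l, _, k, rfl⟩, hd⟩ := exists_lt_of_csInf_lt ⟨_, hmem _⟩ h1
  refine ⟨l - k, ?_⟩
  have h2 : intPt (l - k) = intPt l - intPt k := by
    funext i; simp [intPt]
  rwa [h2, contract_sub, contract_sub, sub_sub_eq_add_sub, add_sub_right_comm]

/-- A set the integer translates of which cover the unit square has measure at least `1`. -/
theorem one_le_volume_of_cover {E : Set Plane} (hE : MeasurableSet E)
    (h : ∀ y ∈ Set.pi Set.univ (fun _ : Fin 2 => Set.Ico (0 : ℝ) 1),
      ∃ n : Fin 2 → ℤ, y - intPt n ∈ E) : 1 ≤ volume E := by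
  set Q : Set Plane := Set.pi Set.univ (fun _ : Fin 2 => Set.Ico (0 : ℝ) 1) with hQ
  have hQm : MeasurableSet Q := MeasurableSet.univ_pi fun _ => measurableSet_Ico
  have hQ1 : volume Q = 1 := by
    rw [hQ, Real.volume_pi_Ico]; simp
  -- Cut the unit square into pieces and move each into `E`; the images lie in distinct lattice
  -- cells, so they are disjoint and keep their total volume.
  set P : (Fin 2 → ℤ) → Set Plane := fun n => (fun z => z + intPt n) ⁻¹' Q with hP
  have hPm : ∀ n, MeasurableSet (P n) := fun n => measurable_add_const _ hQm
  have hdisj : Pairwise (Function.onFun Disjoint fun n => P n ∩ E) := by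
    intro m n hmn
    refine Set.disjoint_left.2 fun z hz hz' => hmn ?_
    funext i
    have a1 := hz.1 i (Set.mem_univ i)
    have a2 := hz'.1 i (Set.mem_univ i)
    simp only [Pi.add_apply, intPt, Set.mem_Ico] at a1 a2
    have b1 : ((m i - n i : ℤ) : ℝ) < 1 := by push_cast; linarith
    have b2 : ((n i - m i : ℤ) : ℝ) < 1 := by push_cast; linarith
    have c1 : m i - n i < 1 := by exact_mod_cast b1
    have c2 : n i - m i < 1 := by exact_mod_cast b2
    omega
  have hcov : Q ⊆ ⋃ n, Q ∩ {y | y - intPt n ∈ E} := fun y hy => by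
    obtain ⟨n, hn⟩ := h y hy
    exact Set.mem_iUnion.2 ⟨n, hy, hn⟩
  calc (1 : ℝ≥0∞) = volume Q := hQ1.symm
    _ ≤ volume (⋃ n, Q ∩ {y | y - intPt n ∈ E}) := measure_mono hcov
    _ ≤ ∑' n, volume (Q ∩ {y | y - intPt n ∈ E}) := measure_iUnion_le _
    _ = ∑' n, volume (P n ∩ E) := by
        refine tsum_congr fun n => ?_
        rw [← measure_preimage_add_right volume (intPt n)]
        congr 1
        ext z
        simp [hP]
    _ = volume (⋃ n, P n ∩ E) :=
        (measure_iUnion hdisj fun n => (hPm n).inter hE).symm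
    _ ≤ volume E := measure_mono (Set.iUnion_subset fun n => Set.inter_subset_right)

/-- The mesh norm is at least the radius of a square of the volume of a lattice cell. -/
theorem le_meshNorm (hA : A.det ≠ 0) {ε : ℝ} (hε : 0 < ε) (J : ℕ) {M : Fin 2 → ℕ}
    (hM : ∀ i, 1 ≤ M i) : ε ≤ 2 * meshNorm A ε J M * √(|(A.det : ℝ)| ^ J) := by
  have hd : 0 < |(A.det : ℝ)| ^ J := pow_pos (abs_pos.2 (by exact_mod_cast hA)) J
  have key : ∀ δ, meshNorm A ε J M < δ → ε ≤ 2 * δ * √(|(A.det : ℝ)| ^ J) := by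
    intro δ hδ
    have hδ0 : 0 < δ := (meshNorm_nonneg A ε J M).trans_lt hδ
    set T := Matrix.toLin' (ε • (powR A J)⁻¹) with hT
    have hdetT : LinearMap.det T = ε ^ 2 * ((A.det : ℝ) ^ J)⁻¹ := by
      rw [hT, LinearMap.det_toLin', Matrix.det_smul, Matrix.det_nonsing_inv, det_powR,
        Ring.inverse_eq_inv']
      simp
    have hAJ : ((A.det : ℝ) ^ J) ≠ 0 := pow_ne_zero _ (by exact_mod_cast hA)
    have hdet0 : LinearMap.det T ≠ 0 := by
      rw [hdetT]; exact mul_ne_zero (by positivity) (inv_ne_zero hAJ)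
    -- A ball of the maximum norm is a square of area `(2 δ) ^ 2`, and its preimage has area `(2 δ)
    -- ^ 2 |det A| ^ J / ε ^ 2`. The unit square lies in `rect M` because `1 ≤ M i`.
    have hcov := one_le_volume_of_cover (E := T ⁻¹' Metric.ball 0 δ)
      (T.continuous_of_finiteDimensional.measurable measurableSet_ball) (fun y hy => by
        obtain ⟨n, hn⟩ := exists_norm_contract_sub_lt hδ (y := y)
          ⟨fun i => by
              have := (hy i (Set.mem_univ i)).1
              have h2 : (0 : ℝ) ≤ M i := Nat.cast_nonneg _
              simp only; linarith,
            fun i => by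
              have := (hy i (Set.mem_univ i)).2
              have h2 : (1 : ℝ) ≤ M i := by exact_mod_cast hM i
              simp only; linarith⟩
        refine ⟨n, ?_⟩
        rw [contract_eq] at hn
        exact mem_ball_zero_iff.2 hn)
    rw [Measure.addHaar_preimage_linearMap volume hdet0, Real.volume_pi_ball _ hδ0,
      ← ENNReal.ofReal_mul (abs_nonneg _), ENNReal.one_le_ofReal, hdetT, mul_inv, inv_inv,
      abs_mul, abs_inv, abs_of_pos (pow_pos hε 2), abs_pow, Fintype.card_fin, inv_mul_eq_div,
      div_mul_eq_mul_div, le_div_iff₀ (pow_pos hε 2), one_mul] at hcov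
    refine (abs_le_of_sq_le_sq' ?_ (by positivity)).2
    rw [mul_pow, Real.sq_sqrt hd.le]
    linarith
  refine le_of_forall_pos_le_add fun η hη => ?_
  have h1 := key (meshNorm A ε J M + η / (2 * √(|(A.det : ℝ)| ^ J)))
    (lt_add_of_pos_right _ (by positivity))
  have h2 : √(|(A.det : ℝ)| ^ J) ≠ 0 := (Real.sqrt_pos.2 hd).ne'
  calc ε ≤ _ := h1
    _ = _ := by field_simp

end Mesh

/-! ### Lower bound for the range of the scaling coefficients -/

section RepBound

variable {A : Matrix (Fin 2) (Fin 2) ℤ} {V : ℤ → Submodule ℂ L2} {φ : Plane → ℂ}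
  {ψ : WIdx A → Plane → ℂ} {a : ℕ}

/-- The functions in `L²(ℝ²)` that vanish outside of `T`. -/
def vanishingOutside (T : Set Plane) : Submodule ℂ L2 where
  carrier := {f | ∀ᵐ x, x ∉ T → f x = 0}
  zero_mem' := by
    filter_upwards [Lp.coeFn_zero ℂ 2 (volume : Measure Plane)] with x hx _
    rw [hx]; rfl
  add_mem' := by
    intro f g hf hg
    change ∀ᵐ x : Plane, x ∉ T → (f + g : L2) x = 0
    filter_upwards [Lp.coeFn_add f g, hf, hg] with x h1 h2 h3 hx
    rw [h1, Pi.add_apply, h2 hx, h3 hx, add_zero]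
  smul_mem' := by
    intro c f hf
    change ∀ᵐ x : Plane, x ∉ T → (c • f : L2) x = 0
    filter_upwards [Lp.coeFn_smul c f, hf] with x h1 h2 hx
    rw [h1, Pi.smul_apply, h2 hx, smul_zero]

theorem atom_mem_vanishingOutside (hA : A.det ≠ 0) {f : Plane → ℂ} (hf : MemLp f 2 volume)
    {u v : ℝ} (hs : SupportedIn f u v) (j : ℕ) (m : Fin 2 → ℤ) :
    atom A f j m ∈ vanishingOutside {x | ∀ i, u ≤ (powR A j *ᵥ x) i - m i ∧
      (powR A j *ᵥ x) i - m i ≤ v} := by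
  have hs' := (quasiMeasurePreserving_mulVec (det_powR_ne_zero hA j)).ae
    (ae_comp_add (-intPt m) hs)
  change ∀ᵐ x, _ → _
  filter_upwards [coeFn_toL2 (memLp_atomFun hA hf j m), hs'] with x h1 h2 hx
  rw [atom, h1, atomFun, sub_eq_add_neg, h2, mul_zero]
  intro h
  refine hx fun i => ⟨?_, ?_⟩
  · simpa [intPt, sub_eq_add_neg] using h.1 i
  · simpa [intPt, sub_eq_add_neg] using h.2 i

theorem exists_mem_inter_of_ne_zero {f : L2} (hf : f ≠ 0) {T U : Set Plane}
    (hT : f ∈ vanishingOutside T) (hU : f ∈ vanishingOutside U) : (T ∩ U).Nonempty := by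
  by_contra hcon
  refine hf (Lp.ext ?_)
  filter_upwards [hT, hU, Lp.coeFn_zero ℂ 2 (volume : Measure Plane)] with x h1 h2 h3
  rw [h3, Pi.zero_apply]
  by_cases hx : x ∈ T
  · exact h2 fun h => hcon ⟨x, hx, h⟩
  · exact h1 hx

/-- A zero row would make the determinant vanish. -/
theorem IsScalingMatrix.one_le_rowSum (hA : IsScalingMatrix A) (j : ℕ) (i : Fin 2) :
    1 ≤ (A ^ j) i 0 + (A ^ j) i 1 := by
  by_contra h
  have h0 := hA.pow_nonneg j i 0
  have h1 := hA.pow_nonneg j i 1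
  have e0 : (A ^ j) i 0 = 0 := by omega
  have e1 : (A ^ j) i 1 = 0 := by omega
  refine pow_ne_zero j hA.det_ne_zero ?_
  rw [← Matrix.det_pow, Matrix.det_fin_two]
  fin_cases i <;> simp_all

/-- The coefficients of the reconstruction space with respect to the scaling functions at scale `J`
extend at least as far as the rows of `A ^ J`. -/
theorem IsRepBound.rowSum_le (hA : IsScalingMatrix A) (hV : IsMRA A V φ)
    (hψ : IsWaveletSystem A V ψ) (ha : 1 ≤ a) (hφ_supp : SupportedIn φ 0 a)
    (hψ_supp : ∀ p, SupportedIn (ψ p) 0 a) {j : ℕ} {L₁ L₂ L₃ L₄ : ℤ}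
    (hL : IsRepBound A φ ψ a (j + 1) L₁ L₂ L₃ L₄) (i : Fin 2) :
    (A ^ (j + 1)) i 0 + (A ^ (j + 1)) i 1 ≤
      max (max |L₁| |L₂|) (max |L₃| |L₄|) + a + (A i 0 + A i 1) := by
  have hdet := hA.det_ne_zero
  have hp : 0 < A.det.natAbs - 1 := by
    have := hA.one_lt_abs_det
    rw [Int.abs_eq_natAbs] at this
    omega
  set K := max (max |L₁| |L₂|) (max |L₃| |L₄|) with hK
  -- The largest admissible translation at the finest scale; the range is open, hence the `- 1`.
  let m : Fin 2 → ℤ := fun k => a * ((A ^ j) k 0 + (A ^ j) k 1) - 1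
  have hm : m ∈ transl A a j := by
    refine Fintype.mem_piFinset.2 fun k => Finset.mem_Ioo.2 ⟨?_, sub_one_lt _⟩
    have h1 := hA.one_le_rowSum j k
    have h2 : (1 : ℤ) ≤ a := by exact_mod_cast ha
    simp only [m]
    nlinarith
  let p : WIdx A := ⟨0, hp⟩
  set f := atom A (ψ p) j m with hf
  have hf0 : f ≠ 0 := (hψ.orthonormal j).ne_zero (p, m)
  have hfR : f ∈ reconSpace A φ ψ a (j + 1) := by
    refine Submodule.mem_sup_right
      (Submodule.mem_iSup_of_mem (⟨j, Nat.lt_succ_self j⟩ : Fin (j + 1)) ?_)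
    exact Submodule.subset_span ⟨(p, ⟨m, hm⟩), rfl⟩
  have hT := atom_mem_vanishingOutside hdet (hψ.memLp p) (hψ_supp p) j m
  have hU : f ∈ vanishingOutside {x | ∀ i, (powR A (j + 1) *ᵥ x) i ≤ K + a} := by
    obtain ⟨α, hα⟩ := hL f hfR
    rw [hα]
    refine Submodule.sum_mem _ fun l₁ h₁ => Submodule.sum_mem _ fun l₂ h₂ =>
      Submodule.smul_mem _ _ ?_
    have h3 := atom_mem_vanishingOutside hdet hV.memLp hφ_supp (j + 1) ![l₁, l₂]
    change ∀ᵐ x, _ → _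
    filter_upwards [h3] with x hx hx'
    refine hx fun h => hx' fun i => ?_
    have h4 := (h i).2
    have h5 : (![l₁, l₂] : Fin 2 → ℤ) i ≤ K := by
      have e1 := (Finset.mem_Icc.1 h₁).2
      have e2 := (Finset.mem_Icc.1 h₂).2
      have g1 : |L₁| ≤ K := (le_max_left _ _).trans (le_max_left _ _)
      have g2 : |L₂| ≤ K := (le_max_right _ _).trans (le_max_left _ _)
      have f1 := le_abs_self L₁
      have f2 := le_abs_self L₂
      fin_cases i
      · simp only [Fin.zero_eta, Matrix.cons_val_zero]; omega
      · simp only [Fin.mk_one, Matrix.cons_val_one, Matrix.cons_val_fin_one]; omega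
    have h6 : (((![l₁, l₂] : Fin 2 → ℤ) i : ℤ) : ℝ) ≤ (K : ℝ) := by exact_mod_cast h5
    linarith
  -- At this point `A^j x ≥ m` by the wavelet support and `A^{j+1} x ≤ K + a` by the representation.
  -- Applying the non-negative matrix `A` to the first gives `(A m)_i ≤ K + a`.
  obtain ⟨x, hx1, hx2⟩ := exists_mem_inter_of_ne_zero hf0 hT hU
  have hpow : powR A (j + 1) = powR A 1 * powR A j := by
    rw [powR_eq_pow A (j + 1), powR_eq_pow A j, pow_succ']
  have h1 := hx2 i
  rw [hpow, ← Matrix.mulVec_mulVec] at h1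
  simp only [Matrix.mulVec, dotProduct, Fin.sum_univ_two] at h1
  have h2 : ∀ k, (m k : ℝ) ≤ (powR A j *ᵥ x) k := fun k => by
    have := (hx1 k).1; linarith
  have h3 : ∀ k, 0 ≤ powR A 1 i k := fun k => by
    rw [powR_one, Matrix.map_apply]; exact_mod_cast hA.nonneg i k
  have h4 := mul_le_mul_of_nonneg_left (h2 0) (h3 0)
  have h5 := mul_le_mul_of_nonneg_left (h2 1) (h3 1)
  simp only [Matrix.mulVec, dotProduct, Fin.sum_univ_two] at h4 h5
  rw [powR_one] at h4 h5 h1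
  simp only [Matrix.map_apply] at h4 h5 h1
  have h6 : ((A i 0 * m 0 + A i 1 * m 1 : ℤ) : ℝ) ≤ ((K + a : ℤ) : ℝ) := by
    push_cast
    linarith
  have h7 : A i 0 * m 0 + A i 1 * m 1 ≤ K + a := by exact_mod_cast h6
  have h8 : ∀ k, (A ^ (j + 1)) i k = A i 0 * (A ^ j) 0 k + A i 1 * (A ^ j) 1 k := fun k => by
    rw [pow_succ', Matrix.mul_apply, Fin.sum_univ_two]
  have h9 : A i 0 * m 0 + A i 1 * m 1 =
      a * ((A ^ (j + 1)) i 0 + (A ^ (j + 1)) i 1) - (A i 0 + A i 1) := by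
    rw [h8, h8]; simp only [m]; ring
  have h10 := hA.one_le_rowSum (j + 1) i
  have h11 : (1 : ℤ) ≤ a := by exact_mod_cast ha
  nlinarith

end RepBound

/-! ### Balanced growth and the stable sampling rate -/

section Rate

variable {A : Matrix (Fin 2) (Fin 2) ℤ} {V : ℤ → Submodule ℂ L2} {φ : Plane → ℂ}
  {ψ : WIdx A → Plane → ℂ} {a : ℕ} {T₁ T₂ : ℝ}

theorem IsScalingMatrix.one_le_sqrt (hA : IsScalingMatrix A) (J : ℕ) :
    1 ≤ √(|(A.det : ℝ)| ^ J) := by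
  rw [Real.one_le_sqrt]
  refine one_le_pow₀ ?_
  exact_mod_cast hA.one_lt_abs_det.le

theorem log_one_div_sqrt_volume_rect_le {M : Fin 2 → ℕ} (hM : ∀ i, 1 ≤ M i) :
    Real.log (1 / √(volume (rect M)).toReal + 1) ≤ 1 := by
  have h1 : 1 ≤ (volume (rect M)).toReal := by
    rw [rect, Real.volume_Icc_pi_toReal (fun i => by
      have : (0 : ℝ) ≤ M i := Nat.cast_nonneg _
      simp only; linarith)]
    rw [Fin.prod_univ_two]
    have h0 : (1 : ℝ) ≤ M 0 := by exact_mod_cast hM 0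
    have h1 : (1 : ℝ) ≤ M 1 := by exact_mod_cast hM 1
    nlinarith
  have h2 : 1 / √(volume (rect M)).toReal ≤ 1 := by
    rw [div_le_one (by positivity)]
    exact Real.one_le_sqrt.2 h1
  have h3 : 0 < 1 / √(volume (rect M)).toReal + 1 := by positivity
  have := Real.log_le_sub_one_of_pos h3
  linarith

/-- The mesh norm assumption forces the dilation to be balanced: the powers of `A` grow like
`|det A| ^ (J / 2)`. -/
theorem MeshAssumption.exists_rowSum_le (hA : IsScalingMatrix A) (hV : IsMRA A V φ)
    (hψ : IsWaveletSystem A V ψ) (ha : 1 ≤ a) (hφ_supp : SupportedIn φ 0 a)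
    (hψ_supp : ∀ p, SupportedIn (ψ p) 0 a) (h : MeshAssumption A φ ψ a T₁ T₂) :
    ∃ C : ℝ, 0 < C ∧ ∀ J : ℕ, 1 ≤ J → ∀ i,
      (((A ^ J) i 0 + (A ^ J) i 1 : ℤ) : ℝ) ≤ C * √(|(A.det : ℝ)| ^ J) := by
  obtain ⟨ε, hε, -, hJ⟩ := h
  have hr : ∀ i, (0 : ℝ) ≤ ((A i 0 + A i 1 : ℤ) : ℝ) := fun i => by
    exact_mod_cast add_nonneg (hA.nonneg i 0) (hA.nonneg i 1)
  refine ⟨ε⁻¹ + a + (((A 0 0 + A 0 1 : ℤ) : ℝ) + ((A 1 0 + A 1 1 : ℤ) : ℝ)), ?_, ?_⟩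
  · have := hr 0
    have := hr 1
    positivity
  intro J hJ1 i
  obtain ⟨L₁, L₂, L₃, L₄, hL, M, hM, hmesh⟩ := hJ J hJ1
  obtain ⟨j, rfl⟩ : ∃ j, J = j + 1 := ⟨J - 1, by omega⟩
  have hrow := hL.rowSum_le hA hV hψ ha hφ_supp hψ_supp i
  set K := max (max |L₁| |L₂|) (max |L₃| |L₄|) with hK
  have hK0 : (0 : ℝ) ≤ (K : ℝ) := by
    exact_mod_cast (abs_nonneg L₁).trans ((le_max_left _ _).trans (le_max_left _ _))
  have hlow := le_meshNorm hA.det_ne_zero hε (j + 1) hM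
  have hs1 := hA.one_le_sqrt (j + 1)
  have hδ0 := meshNorm_nonneg A ε (j + 1) M
  set s := √(|(A.det : ℝ)| ^ (j + 1)) with hs
  set δ := meshNorm A ε (j + 1) M with hδ
  -- For `K = 0` the bound in the assumption is a division by zero, so it would be `0` and the mesh
  -- norm negative.
  have hKpos : 0 < (K : ℝ) := by
    refine lt_of_le_of_ne hK0 fun h0 => ?_
    rw [← h0, mul_zero, div_zero] at hmesh
    exact absurd hmesh (not_lt.2 hδ0)
  have hδK : δ * (4 * Real.pi * K) < 1 := by
    rw [lt_div_iff₀ (by positivity)] at hmesh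
    exact hmesh.trans_le (log_one_div_sqrt_volume_rect_le hM)
  -- Combine `ε ≤ 2 δ s` with `4 π δ K < 1`.
  have hKs : (K : ℝ) ≤ ε⁻¹ * s := by
    rw [inv_mul_eq_div, le_div_iff₀ hε]
    have h1 : K * ε ≤ K * (2 * δ * s) := mul_le_mul_of_nonneg_left hlow hK0
    have h2 : 2 * (δ * K) ≤ δ * (4 * Real.pi * K) := by
      have := mul_nonneg hδ0 hK0
      nlinarith [Real.pi_gt_three]
    nlinarith
  have h3 : (((A ^ (j + 1)) i 0 + (A ^ (j + 1)) i 1 : ℤ) : ℝ) ≤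
      ((K + a + (A i 0 + A i 1) : ℤ) : ℝ) := by exact_mod_cast hrow
  have h4 : ((A i 0 + A i 1 : ℤ) : ℝ) ≤
      ((A 0 0 + A 0 1 : ℤ) : ℝ) + ((A 1 0 + A 1 1 : ℤ) : ℝ) := by
    have := hr 0
    have := hr 1
    fin_cases i <;> simp only [Fin.zero_eta, Fin.mk_one] <;> linarith
  have h5 : (0 : ℝ) ≤ a + (((A 0 0 + A 0 1 : ℤ) : ℝ) + ((A 1 0 + A 1 1 : ℤ) : ℝ)) := by
    have := hr 0
    have := hr 1
    positivity
  -- Since `1 ≤ s`, the additive constants are absorbed into the multiple of `s`.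
  have h6 := mul_le_mul_of_nonneg_left hs1 h5
  calc _ ≤ _ := h3
    _ = (K : ℝ) + a + ((A i 0 + A i 1 : ℤ) : ℝ) := by push_cast; ring
    _ ≤ _ := by linarith

/-- The finest scale alone suffices: for non-negative entries the determinant is at most the product
of the row sums in modulus. -/
theorem IsScalingMatrix.abs_det_pow_le_numRecon (hA : IsScalingMatrix A) (ha : 1 ≤ a) (j : ℕ) :
    |A.det| ^ j ≤ numRecon A a (j + 1) := by
  have ha' : (1 : ℤ) ≤ a := by exact_mod_cast ha
  have hd := hA.one_lt_abs_det
  have hrow : ∀ k i, (A ^ k) i 0 + (A ^ k) i 1 ≤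
      (a : ℤ) * ((A ^ k) i 0 + (A ^ k) i 1 + 1) - 1 := fun k i => by
    have := hA.one_le_rowSum k i
    nlinarith
  have hrow0 : ∀ k i, 0 ≤ (a : ℤ) * ((A ^ k) i 0 + (A ^ k) i 1 + 1) - 1 := fun k i => by
    have := hA.one_le_rowSum k i
    linarith [hrow k i]
  have h1 := Finset.single_le_sum (s := Finset.range (j + 1))
    (f := fun j => ((a : ℤ) * ((A ^ j) 0 0 + (A ^ j) 0 1 + 1) - 1) *
      ((a : ℤ) * ((A ^ j) 1 0 + (A ^ j) 1 1 + 1) - 1))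
    (fun k _ => mul_nonneg (hrow0 k 0) (hrow0 k 1)) (Finset.self_mem_range_succ j)
  have h2 : |A.det| ^ j ≤ ((A ^ j) 0 0 + (A ^ j) 0 1) * ((A ^ j) 1 0 + (A ^ j) 1 1) := by
    rw [← abs_pow, ← Matrix.det_pow, Matrix.det_fin_two, abs_le]
    have e1 := hA.pow_nonneg j 0 0
    have e2 := hA.pow_nonneg j 0 1
    have e3 := hA.pow_nonneg j 1 0
    have e4 := hA.pow_nonneg j 1 1
    have g1 := mul_nonneg e1 e3
    have g2 := mul_nonneg e1 e4
    have g3 := mul_nonneg e2 e3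
    have g4 := mul_nonneg e2 e4
    constructor <;> nlinarith
  have h3 : ((A ^ j) 0 0 + (A ^ j) 0 1) * ((A ^ j) 1 0 + (A ^ j) 1 1) ≤
      ((a : ℤ) * ((A ^ j) 0 0 + (A ^ j) 0 1 + 1) - 1) *
      ((a : ℤ) * ((A ^ j) 1 0 + (A ^ j) 1 1 + 1) - 1) :=
    mul_le_mul (hrow j 0) (hrow j 1) (by linarith [hA.one_le_rowSum j 1]) (hrow0 j 0)
  have h4 := h2.trans (h3.trans h1)
  have h5 : 0 ≤ |A.det| ^ j := by positivity
  rw [numRecon]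
  nlinarith [sq_nonneg (2 * (a : ℤ) - 1)]

theorem card_box (M : Fin 2 → ℕ) : (box M).card = (2 * M 0 + 1) * (2 * M 1 + 1) := by
  rw [box, Fintype.card_piFinset, Fin.prod_univ_two, Int.card_Icc, Int.card_Icc]
  congr 1 <;> omega

/-- The least sampling box that satisfies the size conditions with the constant `S`. -/
def minBox (A : Matrix (Fin 2) (Fin 2) ℤ) (S ε : ℝ) (J : ℕ) : Fin 2 → ℕ :=
  -- The `+ 1` ensures `1 ≤ M i`, as `stableCounts` requires.
  fun i => ⌈(((A ^ J) 0 i + (A ^ J) 1 i : ℤ) : ℝ) / ε * S⌉₊ + 1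

theorem le_minBox (A : Matrix (Fin 2) (Fin 2) ℤ) (S ε : ℝ) (J : ℕ) (i : Fin 2) :
    (((A ^ J) 0 i + (A ^ J) 1 i : ℤ) : ℝ) / ε * S ≤ minBox A S ε J i := by
  rw [minBox, Nat.cast_add_one]
  exact (Nat.le_ceil _).trans (le_add_of_nonneg_right zero_le_one)

/-- For a balanced dilation the least sampling boxes have at most of the order of `N_J` points. -/
theorem card_minBox_isBigO (hA : IsScalingMatrix A) (ha : 1 ≤ a) {C S ε : ℝ} (hC : 0 < C)
    (hS : 0 < S) (hε : 0 < ε)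
    (hrow : ∀ J : ℕ, 1 ≤ J → ∀ i,
      (((A ^ J) i 0 + (A ^ J) i 1 : ℤ) : ℝ) ≤ C * √(|(A.det : ℝ)| ^ J)) :
    (fun J : ℕ => ((box (minBox A S ε J)).card : ℝ)) =O[atTop]
      fun J : ℕ => (numRecon A a J : ℝ) := by
  set D : ℝ := 2 * (2 * C / ε * S + 2) + 1 with hD
  have hD0 : 0 < D := by positivity
  -- `D` bounds one side of the box relative to `s`; the factor `|det A|` pays for `N_J` being
  -- bounded below only by `|det A| ^ (J - 1)`.
  refine IsBigO.of_bound (D ^ 2 * |(A.det : ℝ)|) ?_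
  filter_upwards [eventually_ge_atTop 1] with J hJ
  have hs1 := hA.one_le_sqrt J
  have hssq : √(|(A.det : ℝ)| ^ J) ^ 2 = |(A.det : ℝ)| ^ J := Real.sq_sqrt (by positivity)
  set s := √(|(A.det : ℝ)| ^ J) with hs
  have hside : ∀ i, (2 * (minBox A S ε J i : ℝ) + 1) ≤ D * s := by
    intro i
    have hpos := hA.pow_nonneg J
    -- The box is governed by column sums while `hrow` bounds row sums; the sum of all entries
    -- compares them.
    have h1 : ((A ^ J) 0 i + (A ^ J) 1 i : ℤ) ≤
        ((A ^ J) 0 0 + (A ^ J) 0 1) + ((A ^ J) 1 0 + (A ^ J) 1 1) := by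
      have := hpos 0 0
      have := hpos 0 1
      have := hpos 1 0
      have := hpos 1 1
      fin_cases i <;> simp only [Fin.zero_eta, Fin.mk_one] <;> linarith
    have h2 : (((A ^ J) 0 i + (A ^ J) 1 i : ℤ) : ℝ) ≤ 2 * C * s := by
      have h3 : (((A ^ J) 0 i + (A ^ J) 1 i : ℤ) : ℝ) ≤
        (((A ^ J) 0 0 + (A ^ J) 0 1 : ℤ) : ℝ) + (((A ^ J) 1 0 + (A ^ J) 1 1 : ℤ) : ℝ) := by
        exact_mod_cast h1
      have := hrow J hJ 0
      have := hrow J hJ 1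
      linarith
    have h0 : (0 : ℝ) ≤ (((A ^ J) 0 i + (A ^ J) 1 i : ℤ) : ℝ) := by
      exact_mod_cast add_nonneg (hpos 0 i) (hpos 1 i)
    have h4 : (minBox A S ε J i : ℝ) ≤ (((A ^ J) 0 i + (A ^ J) 1 i : ℤ) : ℝ) / ε * S + 2 := by
      rw [minBox, Nat.cast_add_one]
      have := Nat.ceil_lt_add_one
        (show 0 ≤ (((A ^ J) 0 i + (A ^ J) 1 i : ℤ) : ℝ) / ε * S by positivity)
      linarith
    have h5 : (((A ^ J) 0 i + (A ^ J) 1 i : ℤ) : ℝ) / ε * S ≤ 2 * C * s / ε * S := by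
      gcongr
    have h6 : 2 * C * s / ε * S = 2 * C / ε * S * s := by ring
    rw [hD]
    linarith
  have hcard : ((box (minBox A S ε J)).card : ℝ) ≤ D ^ 2 * |(A.det : ℝ)| ^ J := by
    rw [card_box, ← hssq]
    push_cast
    calc _ ≤ (D * s) * (D * s) :=
          mul_le_mul (hside 0) (hside 1) (by positivity) (by positivity)
      _ = _ := by ring
  obtain ⟨j, rfl⟩ : ∃ j, J = j + 1 := ⟨J - 1, by omega⟩
  have hN : |(A.det : ℝ)| ^ j ≤ (numRecon A a (j + 1) : ℝ) := by
    exact_mod_cast hA.abs_det_pow_le_numRecon ha j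
  rw [Real.norm_natCast, Real.norm_eq_abs]
  refine hcard.trans ?_
  rw [pow_succ' |(A.det : ℝ)| j, ← mul_assoc]
  exact mul_le_mul_of_nonneg_left (hN.trans (le_abs_self _)) (by positivity)

theorem mem_stableCounts_minBox {R : Submodule ℂ L2} [FiniteDimensional ℂ R] {ε θ δ S : ℝ}
    {J : ℕ} (hε : 0 < ε) (hε' : T₁ + T₂ ≤ ε⁻¹)
    (hC : Captures R (samp T₁ T₂ ε) (box (minBox A S ε J)) δ) (hδ0 : 0 ≤ δ) (hδ : δ < 1)
    (h1 : 1 + √δ / (1 - δ) < θ) (h2 : 1 / √(1 - δ) < θ) :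
    (box (minBox A S ε J)).card ∈ stableCounts R (samp T₁ T₂ ε) θ :=
  ⟨minBox A S ε J, fun _ => Nat.le_add_left _ _, rfl,
    hC.exists_recConst_lt (isBessel_samp hε hε' _) hδ0 hδ h1 h2⟩

end Rate

end GSWavelet

end

open GSWavelet in
theorem mainTheorem1
    (A : Matrix (Fin 2) (Fin 2) ℤ) (hA : IsScalingMatrix A)
    (V : ℤ → Submodule ℂ L2) (φ : Plane → ℂ) (ψ : WIdx A → Plane → ℂ)
    (hV : IsMRA A V φ) (hψ : IsWaveletSystem A V ψ)
    (a : ℕ) (ha : 1 ≤ a)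
    (hφ_supp : SupportedIn φ 0 a) (hψ_supp : ∀ p, SupportedIn (ψ p) 0 a)
    (T₁ T₂ : ℝ) (hT₁ : 0 < T₁) (hT₂ : 0 < T₂)
    (hT : ∀ f ∈ reconSpaceFull A φ ψ a, SupportedIn f (-T₁) T₂)
    (θ : ℝ) (hθ : 1 < θ) :
    (∃ S : ℝ, 0 < S ∧
      ∀ (J : ℕ) (ε : ℝ), 0 < ε → ε ≤ 1 / (T₁ + T₂) →
      ∀ M : Fin 2 → ℕ,
        (((A ^ J) 0 0 + (A ^ J) 1 0 : ℤ) : ℝ) / ε * S ≤ M 0 →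
        (((A ^ J) 0 1 + (A ^ J) 1 1 : ℤ) : ℝ) / ε * S ≤ M 1 →
        1 / θ ≤ cosAngle (reconSpace A φ ψ a J) (sampSpace T₁ T₂ ε M)) ∧
    (MeshAssumption A φ ψ a T₁ T₂ →
      ∀ ε : ℝ, 0 < ε → ε ≤ 1 / (T₁ + T₂) →
        (∀ J : ℕ, (stableCounts (reconSpace A φ ψ a J) (samp T₁ T₂ ε) θ).Nonempty) ∧
        (fun J : ℕ =>
            (stableSamplingRate (reconSpace A φ ψ a J) (samp T₁ T₂ ε) θ : ℝ))
          =O[atTop] fun J : ℕ => (numRecon A a J : ℝ)) := by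
  -- One `δ`, and with it one `S`, serves both parts.
  obtain ⟨δ, hδ0, hδ1, hq, hκ⟩ := exists_capture_threshold hθ
  obtain ⟨S, hS, hcap⟩ := exists_captures hA hV hψ hφ_supp hT₁ hT₂ hT hδ0
  have hinv : ∀ ε : ℝ, 0 < ε → ε ≤ 1 / (T₁ + T₂) → T₁ + T₂ ≤ ε⁻¹ := fun ε hε hε1 => by
    rwa [le_inv_comm₀ (add_pos hT₁ hT₂) hε, ← one_div]
  refine ⟨⟨S, hS, fun J ε hε hε1 M hM0 hM1 => ?_⟩, fun hmesh ε hε hε1 => ?_⟩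
  · have hC := hcap J ε hε hε1 M (Fin.forall_fin_two.2 ⟨hM0, hM1⟩)
    have hle := hC.le_cosAngle (U := sampSpace T₁ T₂ ε M)
      (isBessel_samp hε (hinv ε hε hε1) _)
      (fun l hl => Submodule.subset_span ⟨⟨l, hl⟩, rfl⟩) (exists_unit_mem_reconSpace hV ha J)
    refine le_trans ?_ hle
    rw [one_div_le (zero_lt_one.trans hθ) (Real.sqrt_pos.2 (by linarith))]
    exact hκ.le
  · have hmem : ∀ J : ℕ, (box (minBox A S ε J)).card ∈
        stableCounts (reconSpace A φ ψ a J) (samp T₁ T₂ ε) θ := fun J =>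
      mem_stableCounts_minBox hε (hinv ε hε hε1)
        (hcap J ε hε hε1 _ (le_minBox A S ε J)) hδ0.le hδ1 hq hκ
    -- The growth bound no longer refers to the `ε₀` of the assumption, so it applies to every `ε`.
    obtain ⟨C, hC, hrow⟩ := hmesh.exists_rowSum_le hA hV hψ ha hφ_supp hψ_supp
    refine ⟨fun J => ⟨_, hmem J⟩, ?_⟩
    refine IsBigO.trans (IsBigO.of_bound 1 (Eventually.of_forall fun J => ?_))
      (card_minBox_isBigO hA ha hC hS hε hrow)
    rw [one_mul, Real.norm_natCast, Real.norm_natCast]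
    exact_mod_cast Nat.sInf_le (hmem J)
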